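/- Let $n\ge 2$, $1\le s<\frac{n}{n-1}$, and let $D\subset\mathbb R^n$ be an $s$-John domain with John center $x_0$; that is, $D$ is a bounded domain, $x_0\in D$, and there are constants $0<\alpha\le\beta<\infty$ such that every $x\in D$ can be joined to $x_0$ by a rectifiable curve $\gamma_x:[0,\ell(\gamma_x)]\to D$ parametrized by arc length with $\gamma_x(0)=x$, $\gamma_x(\ell(\gamma_x))=x_0$, $\ell(\gamma_x)\le\beta$ and $t^s\le\frac{\beta}{\alpha}\operatorname{dist}(\gamma_x(t),\partial D)$ for all $t\in[0,\ell(\gamma_x)]$. Put $B:=B(x_0,\operatorname{dist}(x_0,\partial D))$ and $p:=\frac{n}{n-s(n-1)}$. Then there exist constants $a,b>0$ such that every $u\in W^{1,1}_{\mathrm{loc}}(D)$ with distributional gradient satisfying $\|\nabla u\|_{L^{p}(D)}\le 1$ is integrable on $B$, and, with $u_B:=\frac1{|B|}\int_B u\,dx$, \[ \int_D \exp\Big(a\,|u-u_B|^{\frac{n}{s(n-1)}}\Big)\,d\mathcal H_\infty^{s(n-1)}\le b . \] Here $\mathcal H^{d}_\infty(E):=\inf\big\{\sum_{i=1}^\infty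 r_i^{d}: E\subset\bigcup_{i=1}^\infty B(x_i,r_i)\big\}$ is the Hausdorff content, the integral is the Choquet integral $\int_D|f|\,d\mathcal H^d_\infty:=\int_0^\infty\mathcal H^d_\infty(\{x\in D:|f(x)|>t\})\,dt$, and in the integrand $u$ denotes any precise representative of the Sobolev function, i.e. one whose value at each Lebesgue point $x\in D$ (each $x$ for which there is $c\in\mathbb R$ with $\frac1{|B(x,r)|}\int_{B(x,r)}|u-c|\,dy\to0$ as $r\to0^+$) is the corresponding $c$; its values at other points are arbitrary. -/

import Mathlib

open MeasureTheory Set Filter Topology Metric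
open scoped ENNReal NNReal ContDiff

/-- `D ⊆ ℝⁿ` is a (bounded) `s`-John domain with John center `x₀`: every `x ∈ D` is joined to `x₀`
inside `D` by a rectifiable curve `γ : [0, ℓ] → D` parametrized by arc length, with `ℓ ≤ β` and
`t ^ s ≤ (β / α) dist (γ t, ∂D)`, where `α, β` do not depend on `x`. -/
def IsJohnDomainWithCenter {n : ℕ} (s : ℝ) (D : Set (EuclideanSpace ℝ (Fin n)))
    (x₀ : EuclideanSpace ℝ (Fin n)) : Prop :=
  IsOpen D ∧ IsConnected D ∧ Bornology.IsBounded D ∧ x₀ ∈ D ∧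
    ∃ α β : ℝ, 0 < α ∧ α ≤ β ∧
      ∀ x ∈ D, ∃ (ℓ : ℝ) (γ : ℝ → EuclideanSpace ℝ (Fin n)),
        0 ≤ ℓ ∧ ℓ ≤ β ∧ HasUnitSpeedOn γ (Icc 0 ℓ) ∧ MapsTo γ (Icc 0 ℓ) D ∧
        γ 0 = x ∧ γ ℓ = x₀ ∧
        ∀ t ∈ Icc 0 ℓ, t ^ s ≤ β / α * infDist (γ t) (frontier D)

/-- The `d`-dimensional Hausdorff content `inf {∑ rᵢ ^ d : E ⊆ ⋃ B(xᵢ, rᵢ)}`, the balls being open.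
For `d > 0`, finite covers are included through balls of radius `0`. -/
noncomputable def hausdorffContent {n : ℕ} (d : ℝ) (E : Set (EuclideanSpace ℝ (Fin n))) : ℝ≥0∞ :=
  ⨅ (x : ℕ → EuclideanSpace ℝ (Fin n)) (r : ℕ → ℝ≥0) (_ : E ⊆ ⋃ i, ball (x i) (r i)),
    ∑' i, (r i : ℝ≥0∞) ^ d

/-- The Choquet integral `∫_D |f| dH_∞^d = ∫_0^∞ H_∞^d {x ∈ D : |f x| > t} dt`. -/
noncomputable def choquetIntegral {n : ℕ} (d : ℝ) (D : Set (EuclideanSpace ℝ (Fin n)))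
    (f : EuclideanSpace ℝ (Fin n) → ℝ) : ℝ≥0∞ :=
  ∫⁻ t in Ioi (0 : ℝ), hausdorffContent d {x ∈ D | t < |f x|}

/-- `u ∈ W^{1,1}_loc(D)` and `g` is its distributional gradient in the open set `D`. -/
def HasWeakGradientOn {n : ℕ} (D : Set (EuclideanSpace ℝ (Fin n)))
    (u : EuclideanSpace ℝ (Fin n) → ℝ)
    (g : EuclideanSpace ℝ (Fin n) → EuclideanSpace ℝ (Fin n)) : Prop :=
  LocallyIntegrableOn u D ∧ LocallyIntegrableOn g D ∧
    ∀ φ : EuclideanSpace ℝ (Fin n) → ℝ, ContDiff ℝ ∞ φ → HasCompactSupport φ → tsupport φ ⊆ D →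
      ∀ w : EuclideanSpace ℝ (Fin n),
        ∫ x in D, u x * fderiv ℝ φ x w = - ∫ x in D, φ x * inner ℝ (g x) w

/-- `v` is a precise representative of `u` in the open set `D`: at every Lebesgue point `x ∈ D` of
`u`, i.e. whenever `⨍_{B(x,r)} |u - c| → 0` as `r → 0` for some `c`, one has `v x = c`. No condition
is put on `v` at the remaining points of `D`, which form a Lebesgue null set when `u` is locally
integrable. The Hausdorff content of the level sets depends on the values of a Sobolev function on
Lebesgue null sets, so that a pointwise representative has to be specified. -/
def IsPreciseRepresentativeOn {n : ℕ} (D : Set (EuclideanSpace ℝ (Fin n)))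
    (u v : EuclideanSpace ℝ (Fin n) → ℝ) : Prop :=
  ∀ x ∈ D, ∀ c : ℝ,
    Tendsto (fun r : ℝ => ⨍ y in ball x r, |u y - c|) (𝓝[>] 0) (𝓝 0) → v x = c

/-! Write d = s(n-1), p = n/(n-d) and q = n/d, so that p and q are conjugate. The proof bounds |u -
u_B| by a dyadic potential of |∇u| and then measures the set where that potential is large.

Potential bound. On the John curve from x, the piece at arc length about t_j = β 2^(-j) stays at
distance at least a multiple of t_j^s from ∂D, so balls of radius r_j ≈ t_j^s centred on it lie in
D. The L¹ Poincaré inequality, applied along a separated net on the piece, shows that averages of u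
over such balls vary by at most C r_j^(1-n) ∫ |∇u| over B(x, 8 t_j) ∩ D. Bounded overlap keeps C
independent of the number of balls. Since r_j^(1-n) ≈ 2^(jd), summing over j bounds the oscillation
between x₀ and x by `dyadicPotential` (`IsJohnDomainWithCenter.exists_chain`). Where the potential
is finite, the averages around x converge and x is a Lebesgue point
(`IsJohnDomainWithCenter.exists_pointwise`), so every precise representative obeys the same bound
there.

Level sets. In the potential the exponents are borderline: 2^(jdq) |B(x, A 2^(-j))| does not depend
on j. Hölder therefore bounds the first J terms by C J^(1/q). The remaining terms decay
geometrically unless, for some k, the integral of |∇u|^p over B(x, A 2^(-J-k)) ∩ D exceeds 2^(-dk)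
(`exists_dyadicPotential_le`). A Vitali covering shows that the exceptional points form a set E_J of
d-content at most C 2^(-dJ) (`hausdorffContent_concentration_le`).

Conclusion. Off E_J one has |u - u_B|^q ≤ K^q (J+1), so for a small the content of {exp(a |u -
u_B|^q) > t} is O(1/(1+t²)), which is integrable in t (`hausdorffContent_exp_superlevel_le`). -/

theorem enorm_sub_le_lintegral_fderiv_segment {E : Type*} [NormedAddCommGroup E]
    [NormedSpace ℝ E] {w : E → ℝ} (hw : ContDiff ℝ 1 w) (x y : E) :
    ‖w x - w y‖ₑ ≤ ‖x - y‖ₑ * ∫⁻ t in Icc (0 : ℝ) 1, ‖fderiv ℝ w ((1 - t) • x + t • y)‖ₑ := by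
  have hd : ∀ t : ℝ, HasDerivAt (fun t : ℝ => w ((1 - t) • x + t • y))
      (fderiv ℝ w ((1 - t) • x + t • y) (y - x)) t := by
    intro t
    have h1 : HasDerivAt (fun t : ℝ => (1 - t) • x + t • y) (y - x) t := by
      have h := (((hasDerivAt_id t).const_sub 1).smul_const x).add
        ((hasDerivAt_id t).smul_const y)
      rw [show y - x = (-1 : ℝ) • x + (1 : ℝ) • y by rw [neg_smul, one_smul, one_smul]; abel]
      exact h
    exact ((hw.differentiable one_ne_zero _).hasFDerivAt).comp_hasDerivAt t h1
  have hc : ContDiff ℝ 1 (fun t : ℝ => w ((1 - t) • x + t • y)) := by fun_prop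
  have h := enorm_sub_le_lintegral_deriv_of_contDiffOn_Icc (hc.contDiffOn (s := Icc 0 1))
    zero_le_one
  have hsymm : ‖w x - w y‖ₑ = ‖w y - w x‖ₑ := by rw [← enorm_neg, neg_sub]
  rw [hsymm]
  simp only [sub_self, zero_smul, one_smul, zero_add, sub_zero, add_zero] at h
  refine h.trans ?_
  rw [← lintegral_const_mul' _ _ enorm_ne_top]
  refine lintegral_mono fun t => ?_
  rw [(hd t).deriv, mul_comm, ← enorm_neg (x - y), neg_sub]
  exact ContinuousLinearMap.le_opENorm _ _

/-! ### Poincaré inequality for C¹ functions on balls. -/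

section PoincareSmooth

variable {E : Type*} [NormedAddCommGroup E] [NormedSpace ℝ E] [FiniteDimensional ℝ E]
  [MeasurableSpace E] [BorelSpace E] (μ : Measure E) [μ.IsAddHaarMeasure]

/-- Change of variables along a homothety mapping `A` into `B`. -/
theorem setLIntegral_comp_homothety_le (G : E → ℝ≥0∞) {a : ℝ} (ha : 0 < a) (c : E)
    {A B : Set E} (hA : MeasurableSet A) (hB : MeasurableSet B)
    (hAB : ∀ x ∈ A, a • x + c ∈ B) :
    ∫⁻ x in A, G (a • x + c) ∂μ
      ≤ ENNReal.ofReal ((a ^ Module.finrank ℝ E)⁻¹) * ∫⁻ x in B, G x ∂μ := by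
  have h1 : ∫⁻ x in A, G (a • x + c) ∂μ ≤ ∫⁻ x, B.indicator G (a • x + c) ∂μ := by
    rw [← lintegral_indicator hA]
    refine lintegral_mono fun x => ?_
    by_cases hx : x ∈ A
    · simp [hx, hAB x hx]
    · simp [hx]
  have h2 : ∫⁻ x, B.indicator G (a • x + c) ∂μ
      = ∫⁻ y, B.indicator G (y + c) ∂(Measure.map (a • ·) μ) :=
    ((Homeomorph.smulOfNeZero a ha.ne').measurableEmbedding.lintegral_map
      (fun y => B.indicator G (y + c))).symm
  rw [Measure.map_addHaar_smul μ ha.ne', lintegral_smul_measure,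
    lintegral_add_right_eq_self (fun y => B.indicator G y) c, lintegral_indicator hB,
    abs_of_nonneg (by positivity)] at h2
  exact h1.trans h2.le

/-- The `L¹` Poincaré inequality on a ball for `C¹` functions, in symmetric form. -/
theorem lintegral_lintegral_enorm_sub_le_of_contDiff {w : E → ℝ} (hw : ContDiff ℝ 1 w)
    (z : E) (r : ℝ) :
    ∫⁻ x in ball z r, ∫⁻ y in ball z r, ‖w x - w y‖ₑ ∂μ ∂μ
      ≤ ENNReal.ofReal (2 * r) * (2 ^ Module.finrank ℝ E * μ (ball z r)
        * ∫⁻ x in ball z r, ‖fderiv ℝ w x‖ₑ ∂μ) := by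
  set B := ball z r with hBdef
  have hB : MeasurableSet B := measurableSet_ball
  set F : E → ℝ≥0∞ := fun x => ‖fderiv ℝ w x‖ₑ with hF
  have hFc : Continuous F := (hw.continuous_fderiv one_ne_zero).enorm
  have hstep : ∀ x ∈ B, ∀ y ∈ B, ‖w x - w y‖ₑ
      ≤ ENNReal.ofReal (2 * r) * ∫⁻ t in Icc (0 : ℝ) 1, F ((1 - t) • x + t • y) := by
    intro x hx y hy
    refine (enorm_sub_le_lintegral_fderiv_segment hw x y).trans ?_
    gcongr
    rw [← ofReal_norm, ← dist_eq_norm]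
    apply ENNReal.ofReal_le_ofReal
    have := dist_triangle_right x y z
    rw [hBdef, mem_ball] at hx hy
    linarith
  have key : ∀ t ∈ Icc (0 : ℝ) 1, ∫⁻ x in B, ∫⁻ y in B, F ((1 - t) • x + t • y) ∂μ ∂μ
      ≤ 2 ^ Module.finrank ℝ E * μ B * ∫⁻ x in B, F x ∂μ := by
    -- For t ≥ 1/2 the homothety y ↦ (1-t)x + ty has ratio at least 1/2, so the change of variables
    -- costs at most 2^dim. For t ≤ 1/2 the roles of x and y are exchanged.
    have aux : ∀ t : ℝ, 1 / 2 ≤ t → t ≤ 1 → ∀ x ∈ B,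
        ∫⁻ y in B, F ((1 - t) • x + t • y) ∂μ
          ≤ 2 ^ Module.finrank ℝ E * ∫⁻ x in B, F x ∂μ := by
      intro t ht ht1 x hx
      have h := setLIntegral_comp_homothety_le μ F (a := t) (by linarith) ((1 - t) • x) hB hB
        (fun y hy => by
          rw [add_comm]
          exact (convex_ball z r) hx hy (by linarith) (by linarith) (by ring))
      simp only [add_comm (t • _)] at h
      refine h.trans ?_
      gcongr
      rw [← inv_pow, ENNReal.ofReal_pow (by positivity)]
      gcongr
      rw [show (2 : ℝ≥0∞) = ENNReal.ofReal 2 by simp]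
      apply ENNReal.ofReal_le_ofReal
      rw [inv_le_comm₀ (by linarith) (by norm_num)]
      linarith
    intro t ht
    rcases le_total (1 / 2) t with h | h
    · calc _ ≤ ∫⁻ x in B, 2 ^ Module.finrank ℝ E * ∫⁻ x in B, F x ∂μ ∂μ :=
            setLIntegral_mono measurable_const fun x hx => aux t h ht.2 x hx
        _ = _ := by rw [setLIntegral_const]; ring
    · rw [lintegral_lintegral_swap (by
        exact (hFc.comp (by fun_prop)).measurable.aemeasurable)]
      calc _ ≤ ∫⁻ x in B, 2 ^ Module.finrank ℝ E * ∫⁻ x in B, F x ∂μ ∂μ := by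
            refine setLIntegral_mono measurable_const fun y hy => ?_
            have := aux (1 - t) (by linarith) (by linarith [ht.1]) y hy
            simp only [sub_sub_cancel] at this
            simpa only [add_comm] using this
        _ = _ := by rw [setLIntegral_const]; ring
  calc ∫⁻ x in B, ∫⁻ y in B, ‖w x - w y‖ₑ ∂μ ∂μ
      ≤ ∫⁻ x in B, ∫⁻ y in B, ENNReal.ofReal (2 * r) *
          (∫⁻ t in Icc (0 : ℝ) 1, F ((1 - t) • x + t • y)) ∂μ ∂μ :=
        setLIntegral_mono' hB fun x hx => setLIntegral_mono' hB fun y hy => hstep x hx y hy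
    _ = ENNReal.ofReal (2 * r) * ∫⁻ x in B, ∫⁻ y in B,
          (∫⁻ t in Icc (0 : ℝ) 1, F ((1 - t) • x + t • y)) ∂μ ∂μ := by
        simp_rw [lintegral_const_mul' _ _ ENNReal.ofReal_ne_top]
    _ = ENNReal.ofReal (2 * r) * ∫⁻ t in Icc (0 : ℝ) 1, ∫⁻ x in B, ∫⁻ y in B,
          F ((1 - t) • x + t • y) ∂μ ∂μ := by
        congr 1
        have h1 : ∀ x, ∫⁻ y in B, (∫⁻ t in Icc (0 : ℝ) 1, F ((1 - t) • x + t • y)) ∂μ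
            = ∫⁻ t in Icc (0 : ℝ) 1, ∫⁻ y in B, F ((1 - t) • x + t • y) ∂μ := fun x =>
          lintegral_lintegral_swap (by
            exact (hFc.comp (by fun_prop)).measurable.aemeasurable)
        simp_rw [h1]
        refine lintegral_lintegral_swap (Measurable.aemeasurable ?_)
        exact Measurable.lintegral_prod_right'
          (f := fun q : (E × ℝ) × E => F ((1 - q.1.2) • q.1.1 + q.1.2 • q.2))
          (hFc.comp (by fun_prop)).measurable
    _ ≤ ENNReal.ofReal (2 * r) * ∫⁻ t in Icc (0 : ℝ) 1,
          2 ^ Module.finrank ℝ E * μ B * ∫⁻ x in B, F x ∂μ := by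
        refine mul_le_mul_right ?_ _
        exact setLIntegral_mono' measurableSet_Icc key
    _ = _ := by rw [setLIntegral_const]; simp

end PoincareSmooth

/-! ### Poincaré inequality for weakly differentiable functions, by mollification. -/

section PoincareWeak

variable {n : ℕ} {D : Set (EuclideanSpace ℝ (Fin n))} {u : EuclideanSpace ℝ (Fin n) → ℝ}
  {g : EuclideanSpace ℝ (Fin n) → EuclideanSpace ℝ (Fin n)}

/-- The mollification of the truncation of `u` to a closed ball. -/
noncomputable def mollify (φ : ContDiffBump (0 : EuclideanSpace ℝ (Fin n)))
    (u : EuclideanSpace ℝ (Fin n) → ℝ) (K : Set (EuclideanSpace ℝ (Fin n))) :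
    EuclideanSpace ℝ (Fin n) → ℝ :=
  convolution (φ.normed volume) (K.indicator u) (ContinuousLinearMap.lsmul ℝ ℝ) volume

theorem HasWeakGradientOn.integrable_indicator (h : HasWeakGradientOn D u g)
    {K : Set (EuclideanSpace ℝ (Fin n))} (hK : IsCompact K) (hKD : K ⊆ D) :
    Integrable (K.indicator u) :=
  (integrable_indicator_iff hK.measurableSet).2 (h.1.integrableOn_compact_subset hKD hK)

theorem contDiff_mollify (h : HasWeakGradientOn D u g)
    (φ : ContDiffBump (0 : EuclideanSpace ℝ (Fin n)))
    {K : Set (EuclideanSpace ℝ (Fin n))} (hK : IsCompact K) (hKD : K ⊆ D) :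
    ContDiff ℝ 1 (mollify φ u K) :=
  HasCompactSupport.contDiff_convolution_left (n := 1) _ φ.hasCompactSupport_normed
    (φ.contDiff_normed (n := 1)) (h.integrable_indicator hK hKD).locallyIntegrable

/-- The differential of the mollified function is the mollified weak gradient. -/
theorem fderiv_mollify_apply (h : HasWeakGradientOn D u g)
    (φ : ContDiffBump (0 : EuclideanSpace ℝ (Fin n)))
    {K : Set (EuclideanSpace ℝ (Fin n))} (hK : IsCompact K) (hKD : K ⊆ D)
    {x : EuclideanSpace ℝ (Fin n)} (hx : closedBall x φ.rOut ⊆ K) (w : EuclideanSpace ℝ (Fin n)) :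
    fderiv ℝ (mollify φ u K) x w
      = ∫ y in D, φ.normed volume (x - y) * inner ℝ (g y) w := by
  have hu_int := (h.integrable_indicator hK hKD).locallyIntegrable
  set ψ := φ.normed volume with hψ
  have hψd : ContDiff ℝ ∞ ψ := φ.contDiff_normed (n := ⊤)
  have hψ1 : ContDiff ℝ 1 ψ := φ.contDiff_normed (n := 1)
  have hψc : HasCompactSupport ψ := φ.hasCompactSupport_normed
  have hψs : tsupport ψ = closedBall 0 φ.rOut := φ.tsupport_normed_eq
  have hflip : mollify φ u K
      = convolution (K.indicator u) ψ (ContinuousLinearMap.lsmul ℝ ℝ).flip volume :=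
    (convolution_flip (ContinuousLinearMap.lsmul ℝ ℝ)).symm
  have hfd := hψc.hasFDerivAt_convolution_right (ContinuousLinearMap.lsmul ℝ ℝ).flip hu_int hψ1 x
  rw [hflip, hfd.fderiv, convolution_precompR_apply _ hu_int (hψc.fderiv ℝ)
    (hψ1.continuous_fderiv one_ne_zero)]
  -- The bump centred at x lives inside K, so truncating u to K does not affect the derivative at x.
  have hzero : ∀ t, t ∉ K → fderiv ℝ ψ (x - t) = 0 := by
    intro t ht
    apply image_eq_zero_of_notMem_tsupport
    intro h'
    apply ht
    apply hx
    have := tsupport_fderiv_subset ℝ h'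
    rw [hψs] at this
    simpa [dist_eq_norm, norm_sub_rev] using this
  have hfψ : ∀ t, fderiv ℝ (fun y => ψ (x - y)) t = -fderiv ℝ ψ (x - t) := by
    intro t
    have h1 : HasFDerivAt (fun y => x - y)
        (-ContinuousLinearMap.id ℝ (EuclideanSpace ℝ (Fin n))) t :=
      (hasFDerivAt_id t).const_sub x
    have h2 := ((hψ1.differentiable one_ne_zero (x - t)).hasFDerivAt).comp t h1
    have h3 : fderiv ℝ (fun y => ψ (x - y)) t = _ := h2.fderiv
    rw [h3]
    ext v
    simp
  have hts : tsupport (fun y => ψ (x - y)) ⊆ closedBall x φ.rOut := by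
    apply closure_minimal _ isClosed_closedBall
    intro y hy
    have : x - y ∈ tsupport ψ := subset_tsupport _ hy
    rw [hψs] at this
    simpa [dist_eq_norm, norm_sub_rev] using this
  have hweak := h.2.2 (fun y => ψ (x - y)) (hψd.comp (contDiff_const.sub contDiff_id))
    (HasCompactSupport.of_support_subset_isCompact (isCompact_closedBall x φ.rOut)
      ((subset_tsupport _).trans hts)) (hts.trans (hx.trans hKD)) w
  rw [eq_neg_iff_add_eq_zero, add_comm, ← eq_neg_iff_add_eq_zero] at hweak
  rw [hweak, ← integral_neg]
  simp only [convolution_def, ContinuousLinearMap.flip_apply, ContinuousLinearMap.lsmul_apply,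
    smul_eq_mul, hfψ]
  rw [← setIntegral_eq_integral_of_forall_compl_eq_zero (s := D)]
  · refine integral_congr_ae (Eventually.of_forall fun t => ?_)
    by_cases ht : t ∈ K
    · simp [ht, mul_comm]
    · simp [hzero t ht]
  · intro t ht
    simp [hzero t fun h' => ht (hKD h')]

/-- Young's inequality for a kernel of mass 1. The gap r' - r ensures that the kernel around a point
of the smaller ball only sees g in the larger one. -/
theorem lintegral_enorm_fderiv_mollify_le (h : HasWeakGradientOn D u g)
    (φ : ContDiffBump (0 : EuclideanSpace ℝ (Fin n))) {z : EuclideanSpace ℝ (Fin n)} {r r' : ℝ}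
    (hφ : φ.rOut ≤ r' - r) (hD : closedBall z r' ⊆ D) :
    ∫⁻ x in ball z r, ‖fderiv ℝ (mollify φ u (closedBall z r')) x‖ₑ
      ≤ ∫⁻ x in ball z r', ‖g x‖ₑ := by
  set ψ := φ.normed volume with hψ
  have hψ0 : ∀ x, 0 ≤ ψ x := φ.nonneg_normed
  have hψm : Measurable ψ := φ.continuous_normed.measurable
  have hgm : AEMeasurable (fun x => ‖g x‖ₑ) (volume.restrict (ball z r')) :=
    ((h.2.1.integrableOn_compact_subset hD (isCompact_closedBall z r')).mono_set
      ball_subset_closedBall).aestronglyMeasurable.enorm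
  have hpt : ∀ x ∈ ball z r, ‖fderiv ℝ (mollify φ u (closedBall z r')) x‖ₑ
      ≤ ∫⁻ y in ball z r', ‖ψ (x - y)‖ₑ * ‖g y‖ₑ := by
    intro x hx
    rw [mem_ball] at hx
    have hxK : closedBall x φ.rOut ⊆ closedBall z r' :=
      closedBall_subset_closedBall' (by linarith)
    refine ContinuousLinearMap.opENorm_le_bound _ fun w => ?_
    rw [fderiv_mollify_apply h φ (isCompact_closedBall z r') hD hxK]
    refine (enorm_integral_le_lintegral_enorm _).trans ?_
    calc ∫⁻ y in D, ‖ψ (x - y) * inner ℝ (g y) w‖ₑ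
        ≤ ∫⁻ y in D, (ball z r').indicator (fun y => ‖ψ (x - y)‖ₑ * ‖g y‖ₑ * ‖w‖ₑ) y := by
          refine lintegral_mono fun y => ?_
          by_cases hy : y ∈ ball z r'
          · simp only [indicator_of_mem hy, enorm_mul, mul_assoc]
            gcongr
            simp only [enorm_eq_nnnorm, ← ENNReal.coe_mul]
            exact_mod_cast nnnorm_inner_le_nnnorm (𝕜 := ℝ) (g y) w
          · have : ψ (x - y) = 0 := by
              rw [← Function.notMem_support, hψ, φ.support_normed_eq]
              intro hmem
              apply hy
              rw [mem_ball, dist_zero_right, ← dist_eq_norm] at hmem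
              rw [mem_ball]
              linarith [dist_triangle_left y z x]
            simp [this]
      _ ≤ ∫⁻ y, (ball z r').indicator (fun y => ‖ψ (x - y)‖ₑ * ‖g y‖ₑ * ‖w‖ₑ) y :=
          setLIntegral_le_lintegral _ _
      _ = _ := by
          rw [lintegral_indicator measurableSet_ball, lintegral_mul_const' _ _ enorm_ne_top]
  have hψi : ∀ y, ∫⁻ x, ‖ψ (x - y)‖ₑ = 1 := by
    intro y
    rw [lintegral_sub_right_eq_self (fun x => ‖ψ x‖ₑ) y]
    have : ∫⁻ x, ‖ψ x‖ₑ = ∫⁻ x, ENNReal.ofReal (ψ x) :=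
      lintegral_congr fun x => Real.enorm_of_nonneg (hψ0 x)
    rw [this, ← ofReal_integral_eq_lintegral_ofReal φ.integrable_normed (ae_of_all _ hψ0),
      φ.integral_normed, ENNReal.ofReal_one]
  calc _ ≤ ∫⁻ x in ball z r, ∫⁻ y in ball z r', ‖ψ (x - y)‖ₑ * ‖g y‖ₑ :=
        setLIntegral_mono' measurableSet_ball hpt
    _ ≤ ∫⁻ x, ∫⁻ y in ball z r', ‖ψ (x - y)‖ₑ * ‖g y‖ₑ := setLIntegral_le_lintegral _ _
    _ = ∫⁻ y in ball z r', ∫⁻ x, ‖ψ (x - y)‖ₑ * ‖g y‖ₑ := by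
        refine lintegral_lintegral_swap ?_
        exact ((hψm.comp (measurable_fst.sub measurable_snd)).enorm.aemeasurable).mul
          hgm.comp_snd
    _ = ∫⁻ y in ball z r', ‖g y‖ₑ := by
        refine lintegral_congr fun y => ?_
        rw [lintegral_mul_const' _ _ enorm_ne_top, hψi, one_mul]

/-- The `L¹` Poincaré inequality on balls for weakly differentiable functions, in symmetric form. -/
theorem HasWeakGradientOn.lintegral_lintegral_enorm_sub_le (h : HasWeakGradientOn D u g)
    {z : EuclideanSpace ℝ (Fin n)} {r r' : ℝ} (hr : r < r') (hD : closedBall z r' ⊆ D) :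
    ∫⁻ x in ball z r, ∫⁻ y in ball z r, ‖u x - u y‖ₑ
      ≤ ENNReal.ofReal (2 * r) * (2 ^ n * volume (ball z r) * ∫⁻ x in ball z r', ‖g x‖ₑ) := by
  set K := closedBall z r' with hK
  have hKc : IsCompact K := isCompact_closedBall z r'
  -- The outer radii tend to 0 without exceeding r' - r. The fixed ratio `rOut = 2 * rIn` is what
  -- almost everywhere convergence of the mollifications requires.
  let φ : ℕ → ContDiffBump (0 : EuclideanSpace ℝ (Fin n)) := fun i =>
    { rIn := (r' - r) / (2 * (i + 1))
      rOut := (r' - r) / (i + 1)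
      rIn_pos := div_pos (by linarith) (by positivity)
      rIn_lt_rOut := by
        have : 0 < r' - r := by linarith
        have hi : (0 : ℝ) < i + 1 := by positivity
        rw [div_lt_div_iff₀ (by positivity) hi]
        nlinarith [mul_pos this hi] }
  have hφr : ∀ i, (φ i).rOut = (r' - r) / (i + 1) := fun i => rfl
  have hφlim : Tendsto (fun i => (φ i).rOut) atTop (𝓝 0) := by
    simp only [hφr]
    have := (tendsto_one_div_add_atTop_nhds_zero_nat (𝕜 := ℝ)).const_mul (r' - r)
    simpa [div_eq_mul_inv] using this
  have hφle : ∀ i, (φ i).rOut ≤ r' - r := fun i => by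
    rw [hφr]
    exact div_le_self (by linarith) (by linarith [(Nat.cast_nonneg i : (0 : ℝ) ≤ i)])
  have hφK : ∀ i, (φ i).rOut ≤ 2 * (φ i).rIn := fun i => by
    rw [hφr, show (φ i).rIn = (r' - r) / (2 * (i + 1)) from rfl]
    apply le_of_eq
    field_simp
  have hae := ContDiffBump.ae_convolution_tendsto_right_of_locallyIntegrable (μ := volume)
    (g := K.indicator u) hφlim (Eventually.of_forall hφK)
    (h.integrable_indicator hKc hD).locallyIntegrable
  have hae' : ∀ᵐ x ∂(volume.restrict (ball z r)),
      Tendsto (fun i => mollify (φ i) u K x) atTop (𝓝 (u x)) := by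
    rw [ae_restrict_iff' measurableSet_ball]
    filter_upwards [hae] with x hx hxb
    have hxK : x ∈ K := ball_subset_closedBall (ball_subset_ball hr.le hxb)
    rw [indicator_of_mem hxK] at hx
    exact hx
  have hcont : ∀ i, Continuous (mollify (φ i) u K) := fun i =>
    (contDiff_mollify h (φ i) hKc hD).continuous
  -- Fatou's lemma is applied in y, then in x; the smooth bound is uniform in i.
  calc ∫⁻ x in ball z r, ∫⁻ y in ball z r, ‖u x - u y‖ₑ
      ≤ ∫⁻ x in ball z r, liminf (fun i =>
          ∫⁻ y in ball z r, ‖mollify (φ i) u K x - mollify (φ i) u K y‖ₑ) atTop := by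
        refine lintegral_mono_ae ?_
        filter_upwards [hae'] with x hx
        calc _ = ∫⁻ y in ball z r,
              liminf (fun i => ‖mollify (φ i) u K x - mollify (φ i) u K y‖ₑ) atTop := by
              refine lintegral_congr_ae ?_
              filter_upwards [hae'] with y hy
              exact ((hx.sub hy).enorm.liminf_eq).symm
          _ ≤ _ := lintegral_liminf_le fun i =>
              ((continuous_const.sub (hcont i)).enorm).measurable
    _ ≤ liminf (fun i => ∫⁻ x in ball z r,
          ∫⁻ y in ball z r, ‖mollify (φ i) u K x - mollify (φ i) u K y‖ₑ) atTop := by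
        refine lintegral_liminf_le fun i => ?_
        exact Measurable.lintegral_prod_right'
          (f := fun q : EuclideanSpace ℝ (Fin n) × EuclideanSpace ℝ (Fin n) =>
            ‖mollify (φ i) u K q.1 - mollify (φ i) u K q.2‖ₑ)
          (((hcont i).comp continuous_fst).sub ((hcont i).comp continuous_snd)).enorm.measurable
    _ ≤ _ := by
        refine liminf_le_of_le (by isBoundedDefault) fun b hb => ?_
        obtain ⟨i, hi⟩ := hb.exists
        refine hi.trans ((lintegral_lintegral_enorm_sub_le_of_contDiff volume
          (contDiff_mollify h (φ i) hKc hD) z r).trans ?_)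
        rw [finrank_euclideanSpace_fin]
        refine mul_le_mul_right (mul_le_mul_right ?_ _) _
        exact lintegral_enorm_fderiv_mollify_le h (φ i) (hφle i) hD

end PoincareWeak

/-! ### Comparison of averages over balls. -/

section Averages

variable {n : ℕ} {D : Set (EuclideanSpace ℝ (Fin n))} {u : EuclideanSpace ℝ (Fin n) → ℝ}
  {g : EuclideanSpace ℝ (Fin n) → EuclideanSpace ℝ (Fin n)}

theorem enorm_average_sub_le {α : Type*} [MeasurableSpace α] {μ : Measure α} {f : α → ℝ}
    {A : Set α} (hA0 : μ A ≠ 0) (hA : μ A ≠ ⊤) (hf : IntegrableOn f A μ) (c : ℝ) :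
    ‖(⨍ x in A, f x ∂μ) - c‖ₑ ≤ (μ A)⁻¹ * ∫⁻ x in A, ‖f x - c‖ₑ ∂μ := by
  have : IsFiniteMeasure (μ.restrict A) := ⟨by simpa using hA.lt_top⟩
  have hreal : μ.real A ≠ 0 := by
    rw [Measure.real, ENNReal.toReal_ne_zero]; exact ⟨hA0, hA⟩
  have h1 : (⨍ x in A, f x ∂μ) - c = (μ.real A)⁻¹ * ∫ x in A, (f x - c) ∂μ := by
    rw [integral_sub hf (integrable_const c), setAverage_eq, setIntegral_const]
    simp only [smul_eq_mul]
    field_simp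
  rw [h1, enorm_mul]
  gcongr
  · rw [enorm_inv hreal, Measure.real, Real.enorm_of_nonneg ENNReal.toReal_nonneg,
      ENNReal.ofReal_toReal hA]
  · exact enorm_integral_le_lintegral_enorm _

/-- The volume of the unit ball of `ℝⁿ`. -/
noncomputable def unitBallVolume (n : ℕ) : ℝ :=
  volume.real (ball (0 : EuclideanSpace ℝ (Fin n)) 1)

theorem unitBallVolume_pos (n : ℕ) : 0 < unitBallVolume n := by
  rw [unitBallVolume, Measure.real]
  exact ENNReal.toReal_pos (measure_ball_pos _ _ one_pos).ne' measure_ball_lt_top.ne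

theorem volume_ball_eq (x : EuclideanSpace ℝ (Fin n)) {r : ℝ} (hr : 0 < r) :
    volume (ball x r) = ENNReal.ofReal (r ^ n * unitBallVolume n) := by
  rw [Measure.addHaar_ball_of_pos _ _ hr, finrank_euclideanSpace_fin,
    ENNReal.ofReal_mul (by positivity), unitBallVolume, ofReal_measureReal]

/-- Oscillation with respect to the average over a smaller ball. -/
theorem HasWeakGradientOn.lintegral_enorm_sub_average_le (h : HasWeakGradientOn D u g)
    {z p : EuclideanSpace ℝ (Fin n)} {r r' ρ : ℝ} (hρ : 0 < ρ) (hr : r < r')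
    (hD : closedBall z r' ⊆ D) (hsub : ball p ρ ⊆ ball z r) :
    ∫⁻ x in ball z r, ‖u x - ⨍ y in ball p ρ, u y‖ₑ
      ≤ ENNReal.ofReal (2 ^ (n + 1) * r ^ (n + 1) / ρ ^ n) * ∫⁻ x in ball z r', ‖g x‖ₑ := by
  have hr0 : 0 < r := pos_of_mem_ball (hsub (mem_ball_self hρ))
  have hA0 : volume (ball p ρ) ≠ 0 := (measure_ball_pos _ _ hρ).ne'
  have hA : volume (ball p ρ) ≠ ⊤ := measure_ball_lt_top.ne
  have hu_int : IntegrableOn u (ball p ρ) :=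
    (h.1.integrableOn_compact_subset hD (isCompact_closedBall z r')).mono_set
      (hsub.trans ((ball_subset_ball hr.le).trans ball_subset_closedBall))
  calc ∫⁻ x in ball z r, ‖u x - ⨍ y in ball p ρ, u y‖ₑ
      ≤ ∫⁻ x in ball z r, (volume (ball p ρ))⁻¹ * ∫⁻ y in ball z r, ‖u x - u y‖ₑ := by
        refine lintegral_mono fun x => ?_
        have h1 := enorm_average_sub_le hA0 hA hu_int (u x)
        rw [← enorm_neg, neg_sub]
        refine h1.trans ?_
        refine mul_le_mul_right ?_ _
        calc _ = ∫⁻ y in ball p ρ, ‖u x - u y‖ₑ :=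
              lintegral_congr fun y => by rw [← enorm_neg, neg_sub]
          _ ≤ _ := lintegral_mono_set hsub
    _ = (volume (ball p ρ))⁻¹ * ∫⁻ x in ball z r, ∫⁻ y in ball z r, ‖u x - u y‖ₑ :=
        lintegral_const_mul' _ _ (ENNReal.inv_ne_top.2 hA0)
    _ ≤ (volume (ball p ρ))⁻¹ * (ENNReal.ofReal (2 * r) *
          (2 ^ n * volume (ball z r) * ∫⁻ x in ball z r', ‖g x‖ₑ)) := by
        gcongr
        exact h.lintegral_lintegral_enorm_sub_le hr hD
    _ = _ := by
        have hω := unitBallVolume_pos n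
        rw [volume_ball_eq p hρ, volume_ball_eq z hr0, ← ENNReal.ofReal_inv_of_pos (by positivity),
          show (2 : ℝ≥0∞) ^ n = ENNReal.ofReal (2 ^ n) by
            rw [ENNReal.ofReal_pow (by norm_num)]; simp]
        simp only [← mul_assoc]
        rw [← ENNReal.ofReal_mul (by positivity), ← ENNReal.ofReal_mul (by positivity),
          ← ENNReal.ofReal_mul (by positivity)]
        congr 2
        field_simp
        ring

/-- Comparison of the averages over two balls contained in a third one. -/
theorem HasWeakGradientOn.enorm_average_sub_average_le (h : HasWeakGradientOn D u g)
    {z p p' : EuclideanSpace ℝ (Fin n)} {r r' ρ ρ' : ℝ} (hρ : 0 < ρ) (hρ' : 0 < ρ') (hr : r < r')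
    (hD : closedBall z r' ⊆ D) (hsub : ball p ρ ⊆ ball z r) (hsub' : ball p' ρ' ⊆ ball z r) :
    ‖(⨍ y in ball p ρ, u y) - ⨍ y in ball p' ρ', u y‖ₑ
      ≤ ENNReal.ofReal (2 ^ (n + 1) / unitBallVolume n * (r ^ (n + 1) / (ρ ^ n * ρ' ^ n)))
        * ∫⁻ x in ball z r', ‖g x‖ₑ := by
  have hr0 : 0 < r := pos_of_mem_ball (hsub (mem_ball_self hρ))
  have hu_int : IntegrableOn u (ball p ρ) :=
    (h.1.integrableOn_compact_subset hD (isCompact_closedBall z r')).mono_set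
      (hsub.trans ((ball_subset_ball hr.le).trans ball_subset_closedBall))
  have hω := unitBallVolume_pos n
  calc _ ≤ (volume (ball p ρ))⁻¹ * ∫⁻ x in ball p ρ, ‖u x - ⨍ y in ball p' ρ', u y‖ₑ :=
        enorm_average_sub_le (measure_ball_pos _ _ hρ).ne' measure_ball_lt_top.ne hu_int _
    _ ≤ (volume (ball p ρ))⁻¹ * (ENNReal.ofReal (2 ^ (n + 1) * r ^ (n + 1) / ρ' ^ n)
          * ∫⁻ x in ball z r', ‖g x‖ₑ) := by
        gcongr
        exact (lintegral_mono_set hsub).trans (h.lintegral_enorm_sub_average_le hρ' hr hD hsub')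
    _ = _ := by
        rw [volume_ball_eq p hρ, ← ENNReal.ofReal_inv_of_pos (by positivity), ← mul_assoc,
          ← ENNReal.ofReal_mul (by positivity)]
        congr 2
        field_simp

/-- A dimensional constant for the comparison of averages over concentric balls. -/
noncomputable def concentricConst (n : ℕ) : ℝ := 2 ^ (n + 1) / unitBallVolume n * 2 ^ (n + 1)

theorem concentricConst_pos (n : ℕ) : 0 < concentricConst n := by
  have := unitBallVolume_pos n
  rw [concentricConst]; positivity

/-- Averages over concentric balls of dyadically comparable radii, by telescoping. -/
theorem HasWeakGradientOn.enorm_average_sub_average_concentric_le (hn : 2 ≤ n)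
    (h : HasWeakGradientOn D u g) (p : EuclideanSpace ℝ (Fin n)) (m : ℕ) {ρ : ℝ} (hρ : 0 < ρ)
    {r' : ℝ} (hr' : 2 ^ m * ρ < r') (hD : closedBall p r' ⊆ D) :
    ‖(⨍ y in ball p ρ, u y) - ⨍ y in ball p (2 ^ m * ρ), u y‖ₑ
      ≤ ENNReal.ofReal (2 * concentricConst n * (ρ / ρ ^ n)) * ∫⁻ x in ball p r', ‖g x‖ₑ := by
  induction m generalizing ρ with
  | zero => simp
  | succ m ih =>
    have h2 : (1 : ℝ) ≤ 2 ^ m := one_le_pow₀ (by norm_num)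
    have hC := concentricConst_pos n
    have hlt : 2 * ρ < r' := by
      refine lt_of_le_of_lt ?_ hr'
      rw [pow_succ]
      nlinarith
    have e1 := h.enorm_average_sub_average_le (z := p) (p := p) (p' := p) (ρ := ρ) (ρ' := 2 * ρ)
      (r := 2 * ρ) hρ (by positivity) hlt hD (ball_subset_ball (by linarith)) subset_rfl
    have e2 := ih (ρ := 2 * ρ) (by positivity) (by rw [← mul_assoc, ← pow_succ]; exact hr')
    rw [← mul_assoc, ← pow_succ] at e2
    have htri : ‖(⨍ y in ball p ρ, u y) - ⨍ y in ball p (2 ^ (m + 1) * ρ), u y‖ₑ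
        ≤ ‖(⨍ y in ball p ρ, u y) - ⨍ y in ball p (2 * ρ), u y‖ₑ
          + ‖(⨍ y in ball p (2 * ρ), u y) - ⨍ y in ball p (2 ^ (m + 1) * ρ), u y‖ₑ := by
      refine le_trans (le_of_eq ?_) (enorm_add_le _ _)
      congr 1; ring
    refine htri.trans ((add_le_add e1 e2).trans ?_)
    rw [← add_mul, ← ENNReal.ofReal_add (by have := unitBallVolume_pos n; positivity)
      (by positivity)]
    gcongr
    obtain ⟨k, rfl⟩ : ∃ k, n = k + 2 := ⟨n - 2, by omega⟩
    have e3 : 2 ^ (k + 2 + 1) / unitBallVolume (k + 2)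
        * ((2 * ρ) ^ (k + 2 + 1) / (ρ ^ (k + 2) * (2 * ρ) ^ (k + 2)))
        ≤ concentricConst (k + 2) * (ρ / ρ ^ (k + 2)) := by
      rw [concentricConst, mul_assoc]
      have := unitBallVolume_pos (k + 2)
      gcongr ?_ * ?_
      rw [show (2 * ρ) ^ (k + 2 + 1) / (ρ ^ (k + 2) * (2 * ρ) ^ (k + 2))
        = 2 * (ρ / ρ ^ (k + 2)) by rw [pow_succ (2 * ρ)]; field_simp]
      gcongr
      exact le_self_pow₀ (by norm_num) (by omega)
    -- Since n ≥ 2, doubling the radius at least halves ρ^(1-n). The induction closes with constant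
    -- 2C because C + 2C · (1/2) = 2C.
    have e4 : 2 * ρ / (2 * ρ) ^ (k + 2) ≤ 1 / 2 * (ρ / ρ ^ (k + 2)) := by
      rw [mul_pow, mul_div_mul_comm]
      refine mul_le_mul_of_nonneg_right ?_ (by positivity)
      rw [div_le_div_iff₀ (by positivity) (by norm_num), pow_add]
      have : (1 : ℝ) ≤ 2 ^ k := one_le_pow₀ (by norm_num)
      linarith
    calc _ ≤ concentricConst (k + 2) * (ρ / ρ ^ (k + 2))
          + 2 * concentricConst (k + 2) * (1 / 2 * (ρ / ρ ^ (k + 2))) := by gcongr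
      _ = _ := by ring

end Averages

/-! ### Chaining of averages along a continuum. -/

section Chaining

/-- If the open sets `U z`, `z ∈ Z`, cover a preconnected set, then a function on `Z` whose increments
between neighbours are controlled by weights has its total oscillation controlled by the sum of the
weights: the intervals `[f z - w z, f z + w z]` cover all intermediate values. -/
theorem abs_sub_le_two_mul_sum_of_isPreconnected {X : Type*} [TopologicalSpace X] {K : Set X}
    (hK : IsPreconnected K) (Z : Finset X) (U : X → Set X) (hU : ∀ z ∈ Z, IsOpen (U z))
    (hcov : K ⊆ ⋃ z ∈ Z, U z) (hne : ∀ z ∈ Z, (K ∩ U z).Nonempty) (f w : X → ℝ)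
    (hw : ∀ z ∈ Z, 0 ≤ w z)
    (hadj : ∀ z ∈ Z, ∀ z' ∈ Z, (U z ∩ U z').Nonempty → |f z - f z'| ≤ w z + w z')
    {z z' : X} (hz : z ∈ Z) (hz' : z' ∈ Z) : |f z - f z'| ≤ 2 * ∑ y ∈ Z, w y := by
  wlog hle : f z ≤ f z' generalizing z z'
  · rw [abs_sub_comm]
    exact this hz' hz (le_of_not_ge hle)
  -- A value c missed by all intervals splits Z into points entirely below c and points entirely
  -- above. By `hadj` the open sets of the two families cannot meet, which contradicts
  -- preconnectedness.
  have hsub : Icc (f z) (f z') ⊆ ⋃ y ∈ Z, Icc (f y - w y) (f y + w y) := by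
    intro c hc
    by_contra hnot
    have hdich : ∀ y ∈ Z, c < f y - w y ∨ f y + w y < c := by
      intro y hy
      by_contra! hcon
      exact hnot (mem_biUnion hy ⟨hcon.1, hcon.2⟩)
    set V := ⋃ y ∈ Z, ⋃ (_ : f y + w y < c), U y with hV
    set V' := ⋃ y ∈ Z, ⋃ (_ : c < f y - w y), U y with hV'
    have hVo : IsOpen V := isOpen_biUnion fun y hy => isOpen_iUnion fun _ => hU y hy
    have hVo' : IsOpen V' := isOpen_biUnion fun y hy => isOpen_iUnion fun _ => hU y hy
    have h1 : K ⊆ V ∪ V' := by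
      intro x hx
      obtain ⟨y, hy, hxy⟩ := mem_iUnion₂.1 (hcov hx)
      rcases hdich y hy with h | h
      · exact Or.inr (mem_biUnion hy (mem_iUnion.2 ⟨h, hxy⟩))
      · exact Or.inl (mem_biUnion hy (mem_iUnion.2 ⟨h, hxy⟩))
    have h2 : (K ∩ V).Nonempty := by
      obtain ⟨x, hx, hxz⟩ := hne z hz
      refine ⟨x, hx, mem_biUnion hz (mem_iUnion.2 ⟨?_, hxz⟩)⟩
      rcases hdich z hz with h | h
      · linarith [hc.1, hw z hz]
      · exact h
    have h3 : (K ∩ V').Nonempty := by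
      obtain ⟨x, hx, hxz⟩ := hne z' hz'
      refine ⟨x, hx, mem_biUnion hz' (mem_iUnion.2 ⟨?_, hxz⟩)⟩
      rcases hdich z' hz' with h | h
      · exact h
      · linarith [hc.2, hw z' hz']
    obtain ⟨x, -, hxV, hxV'⟩ := hK V V' hVo hVo' h1 h2 h3
    simp only [hV, hV', mem_iUnion] at hxV hxV'
    obtain ⟨y, hy, hyc, hxy⟩ := hxV
    obtain ⟨y', hy', hyc', hxy'⟩ := hxV'
    have := hadj y hy y' hy' ⟨x, hxy, hxy'⟩
    rw [abs_le] at this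
    linarith [this.1]
  have hvol : volume (Icc (f z) (f z')) ≤ ENNReal.ofReal (2 * ∑ y ∈ Z, w y) := by
    refine (measure_mono hsub).trans ((measure_biUnion_finset_le _ _).trans (le_of_eq ?_))
    rw [Finset.mul_sum, ENNReal.ofReal_sum_of_nonneg fun y hy => by linarith [hw y hy]]
    refine Finset.sum_congr rfl fun y _ => ?_
    rw [Real.volume_Icc]
    congr 1; ring
  rw [Real.volume_Icc, ENNReal.ofReal_le_ofReal_iff
    (mul_nonneg zero_le_two (Finset.sum_nonneg hw))] at hvol
  rw [abs_sub_comm, abs_of_nonneg (by linarith)]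
  exact hvol

theorem enorm_sub_le_two_mul_sum_of_isPreconnected {X : Type*} [TopologicalSpace X] {K : Set X}
    (hK : IsPreconnected K) (Z : Finset X) (U : X → Set X) (hU : ∀ z ∈ Z, IsOpen (U z))
    (hcov : K ⊆ ⋃ z ∈ Z, U z) (hne : ∀ z ∈ Z, (K ∩ U z).Nonempty) (f : X → ℝ) (w : X → ℝ≥0∞)
    (hadj : ∀ z ∈ Z, ∀ z' ∈ Z, (U z ∩ U z').Nonempty → ‖f z - f z'‖ₑ ≤ w z + w z')
    {z z' : X} (hz : z ∈ Z) (hz' : z' ∈ Z) : ‖f z - f z'‖ₑ ≤ 2 * ∑ y ∈ Z, w y := by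
  by_cases htop : ∑ y ∈ Z, w y = ⊤
  · rw [htop, ENNReal.mul_top two_ne_zero]; exact le_top
  have hfin : ∀ y ∈ Z, w y ≠ ⊤ := fun y hy h => htop (ENNReal.sum_eq_top.2 ⟨y, hy, h⟩)
  have h := abs_sub_le_two_mul_sum_of_isPreconnected hK Z U hU hcov hne f (fun y => (w y).toReal)
    (fun y _ => ENNReal.toReal_nonneg) (fun y hy y' hy' hyy' => by
      have := hadj y hy y' hy' hyy'
      rw [Real.enorm_eq_ofReal_abs] at this
      rw [← ENNReal.toReal_add (hfin y hy) (hfin y' hy')]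
      exact (ENNReal.ofReal_le_iff_le_toReal
        (ENNReal.add_ne_top.2 ⟨hfin y hy, hfin y' hy'⟩)).1 this) hz hz'
  rw [← ENNReal.toReal_sum hfin, show (2 : ℝ) = (2 : ℝ≥0∞).toReal by simp,
    ← ENNReal.toReal_mul] at h
  rw [Real.enorm_eq_ofReal_abs]
  exact ENNReal.ofReal_le_of_le_toReal h

/-- A compact set has a finite net of mesh `r` whose points are `r / 2`-separated. -/
theorem IsCompact.exists_finset_separated_net {X : Type*} [PseudoMetricSpace X] {K : Set X}
    (hK : IsCompact K) {r : ℝ} (hr : 0 < r) :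
    ∃ Z : Finset X, (Z : Set X) ⊆ K ∧ (∀ z ∈ Z, ∀ z' ∈ Z, z ≠ z' → r / 2 ≤ dist z z') ∧
      K ⊆ ⋃ z ∈ Z, ball z r := by
  classical
  obtain ⟨t, htK, htf, htc⟩ := hK.finite_cover_balls (half_pos hr)
  -- A maximal separated subset of a finite r/2-net: by maximality every net point is within r/2 of
  -- it, so its mesh is r.
  obtain ⟨Z, hZ⟩ := (htf.toFinset.powerset.filter fun Z : Finset X =>
    ∀ z ∈ Z, ∀ z' ∈ Z, z ≠ z' → r / 2 ≤ dist z z').exists_maximal ⟨∅, by simp⟩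
  obtain ⟨hZmem, hZmax⟩ := hZ
  simp only [Finset.mem_filter, Finset.mem_powerset] at hZmem hZmax
  have hZt : ∀ z ∈ Z, z ∈ t := fun z hz => htf.mem_toFinset.1 (hZmem.1 hz)
  refine ⟨Z, fun z hz => htK (hZt z hz), hZmem.2, fun x hx => ?_⟩
  obtain ⟨y, hy, hxy⟩ := mem_iUnion₂.1 (htc hx)
  rw [mem_ball] at hxy
  have hyZ : ∃ z ∈ Z, dist y z < r / 2 := by
    by_contra! hcon
    have hins : y ∈ Z := by
      refine hZmax (y := insert y Z) ⟨?_, ?_⟩ (Finset.subset_insert _ _)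
        (Finset.mem_insert_self y Z)
      · exact Finset.insert_subset (htf.mem_toFinset.2 hy) hZmem.1
      · intro a ha b hb hab
        rcases Finset.mem_insert.1 ha with rfl | haZ
        · rcases Finset.mem_insert.1 hb with rfl | hb
          · exact absurd rfl hab
          · exact hcon b hb
        · rcases Finset.mem_insert.1 hb with rfl | hb
          · rw [dist_comm]; exact hcon a haZ
          · exact hZmem.2 a haZ b hb hab
    have := hcon y hins
    rw [dist_self] at this
    linarith
  obtain ⟨z, hz, hyz⟩ := hyZ
  exact mem_biUnion hz (mem_ball.2 (by linarith [dist_triangle x y z]))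

variable {n : ℕ}

open scoped Classical in
/-- Bounded overlap of the balls of radius `4 * r` around an `r / 2`-separated set. -/
theorem card_filter_dist_lt_le (Z : Finset (EuclideanSpace ℝ (Fin n))) {r : ℝ} (hr : 0 < r)
    (hsep : ∀ z ∈ Z, ∀ z' ∈ Z, z ≠ z' → r / 2 ≤ dist z z') (y : EuclideanSpace ℝ (Fin n)) :
    (Z.filter fun z => y ∈ ball z (4 * r)).card ≤ 17 ^ n := by
  set Y := Z.filter fun z => y ∈ ball z (4 * r) with hY
  have hYZ : ∀ z ∈ Y, z ∈ Z := fun z hz => (Finset.mem_filter.1 hz).1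
  have hdisj : (Y : Set (EuclideanSpace ℝ (Fin n))).PairwiseDisjoint fun z => ball z (r / 4) := by
    intro a ha b hb hab
    refine ball_disjoint_ball ?_
    linarith [hsep a (hYZ a ha) b (hYZ b hb) hab]
  -- Volume counting: disjoint balls of radius r/4 sit in a ball of radius 4r + r/4 = 17(r/4).
  have hsub : (⋃ z ∈ Y, ball z (r / 4)) ⊆ ball y (17 * (r / 4)) := by
    refine iUnion₂_subset fun z hz => ball_subset_ball' ?_
    have := (Finset.mem_filter.1 hz).2
    rw [mem_ball, dist_comm] at this
    linarith
  have h := measure_mono (μ := volume) hsub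
  rw [measure_biUnion_finset hdisj fun _ _ => measurableSet_ball] at h
  have hω := unitBallVolume_pos n
  rw [volume_ball_eq y (by positivity)] at h
  simp only [volume_ball_eq _ (show (0 : ℝ) < r / 4 by positivity), Finset.sum_const,
    nsmul_eq_mul] at h
  rw [← ENNReal.ofReal_natCast, ← ENNReal.ofReal_mul (by positivity),
    ENNReal.ofReal_le_ofReal_iff (by positivity), mul_pow, mul_assoc] at h
  have h' := le_of_mul_le_mul_right h (by positivity)
  exact_mod_cast h'

theorem sum_setLIntegral_ball_le {G : EuclideanSpace ℝ (Fin n) → ℝ≥0∞}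
    (Z : Finset (EuclideanSpace ℝ (Fin n))) {r : ℝ} (hr : 0 < r)
    (hsep : ∀ z ∈ Z, ∀ z' ∈ Z, z ≠ z' → r / 2 ≤ dist z z') {S : Set (EuclideanSpace ℝ (Fin n))}
    (hG : AEMeasurable G (volume.restrict S)) (hS : ∀ z ∈ Z, ball z (4 * r) ⊆ S) :
    ∑ z ∈ Z, ∫⁻ x in ball z (4 * r), G x ≤ 17 ^ n * ∫⁻ x in S, G x := by
  have h1 : ∀ z ∈ Z, ∫⁻ x in ball z (4 * r), G x
      = ∫⁻ x in S, (ball z (4 * r)).indicator G x := by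
    intro z hz
    rw [lintegral_indicator measurableSet_ball, Measure.restrict_restrict measurableSet_ball,
      inter_eq_left.2 (hS z hz)]
  rw [Finset.sum_congr rfl h1,
    ← lintegral_finsetSum' _ fun z _ => hG.indicator measurableSet_ball,
    ← lintegral_const_mul'' _ hG]
  refine lintegral_mono fun x => ?_
  classical
  calc ∑ z ∈ Z, (ball z (4 * r)).indicator G x
      = ∑ z ∈ Z.filter (fun z => x ∈ ball z (4 * r)), G x := by
        rw [Finset.sum_filter]
        exact Finset.sum_congr rfl fun z _ => by simp [indicator_apply]
    _ ≤ 17 ^ n * G x := by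
        rw [Finset.sum_const, nsmul_eq_mul]
        gcongr
        exact_mod_cast card_filter_dist_lt_le Z hr hsep x

/-- Oscillation of the averages over balls of fixed radius centred on a continuum. -/
theorem HasWeakGradientOn.enorm_average_sub_average_le_of_isPreconnected
    {D : Set (EuclideanSpace ℝ (Fin n))} {u : EuclideanSpace ℝ (Fin n) → ℝ}
    {g : EuclideanSpace ℝ (Fin n) → EuclideanSpace ℝ (Fin n)} (h : HasWeakGradientOn D u g)
    {K : Set (EuclideanSpace ℝ (Fin n))} (hKp : IsPreconnected K) (hKc : IsCompact K)
    {r : ℝ} (hr : 0 < r) (hKD : ∀ y ∈ K, closedBall y (4 * r) ⊆ D)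
    {S : Set (EuclideanSpace ℝ (Fin n))} (hSD : S ⊆ D) (hS : ∀ y ∈ K, ball y (4 * r) ⊆ S)
    {p p' : EuclideanSpace ℝ (Fin n)} (hp : p ∈ K) (hp' : p' ∈ K) :
    ‖(⨍ y in ball p r, u y) - ⨍ y in ball p' r, u y‖ₑ
      ≤ ENNReal.ofReal (4 * (2 ^ (n + 1) / unitBallVolume n * 3 ^ (n + 1)) * 17 ^ n * (r / r ^ n))
        * ∫⁻ x in S, ‖g x‖ₑ := by
  have hω := unitBallVolume_pos n
  set C := 2 ^ (n + 1) / unitBallVolume n * 3 ^ (n + 1) * (r / r ^ n) with hC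
  have hC0 : 0 ≤ C := by positivity
  obtain ⟨Z, hZK, hsep, hcov⟩ := hKc.exists_finset_separated_net hr
  set f : EuclideanSpace ℝ (Fin n) → ℝ := fun p => ⨍ y in ball p r, u y with hf
  set w : EuclideanSpace ℝ (Fin n) → ℝ≥0∞ := fun p =>
    ENNReal.ofReal C * ∫⁻ x in ball p (4 * r), ‖g x‖ₑ with hw
  -- Both balls of radius r lie in the ball of radius 3r around a, which leaves a margin up to 4r
  -- for Poincaré.
  have hstep : ∀ a ∈ K, ∀ b, dist b a < 2 * r → ‖f b - f a‖ₑ ≤ w a := by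
    intro a ha b hab
    have := h.enorm_average_sub_average_le (z := a) (p := b) (p' := a) (ρ := r) (ρ' := r)
      (r := 3 * r) (r' := 4 * r) hr hr (by linarith) (hKD a ha)
      (ball_subset_ball' (by linarith)) (ball_subset_ball (by linarith))
    refine this.trans (le_of_eq ?_)
    rw [hw]
    congr 2
    rw [hC, mul_pow, pow_succ r]
    field_simp
  have hmeas : AEMeasurable (fun x => ‖g x‖ₑ) (volume.restrict S) :=
    (h.2.1.aestronglyMeasurable.mono_measure (Measure.restrict_mono_set _ hSD)).enorm
  have hsum : ∑ z ∈ Z, w z ≤ ENNReal.ofReal C * (17 ^ n * ∫⁻ x in S, ‖g x‖ₑ) := by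
    rw [hw, ← Finset.mul_sum]
    gcongr
    exact sum_setLIntegral_ball_le Z hr hsep hmeas fun z hz => hS z (hZK hz)
  have hnet : ∀ q ∈ K, ∃ z ∈ Z, ‖f q - f z‖ₑ ≤ ∑ z ∈ Z, w z := by
    intro q hq
    obtain ⟨z, hz, hqz⟩ := mem_iUnion₂.1 (hcov hq)
    refine ⟨z, hz, (hstep z (hZK hz) q (by rw [mem_ball] at hqz; linarith)).trans ?_⟩
    exact Finset.single_le_sum (f := w) (fun _ _ => zero_le) hz
  obtain ⟨z, hz, hpz⟩ := hnet p hp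
  obtain ⟨z', hz', hpz'⟩ := hnet p' hp'
  have hchain := enorm_sub_le_two_mul_sum_of_isPreconnected hKp Z (fun z => ball z r)
    (fun _ _ => isOpen_ball) hcov (fun z hz => ⟨z, hZK hz, mem_ball_self hr⟩) f w
    (fun a ha b hb hab => by
      obtain ⟨x, hxa, hxb⟩ := hab
      rw [mem_ball] at hxa hxb
      exact (hstep b (hZK hb) a (by linarith [dist_triangle_left a b x])).trans
        le_add_self) hz hz'
  have htri : ‖f p - f p'‖ₑ ≤ ‖f p - f z‖ₑ + ‖f z - f z'‖ₑ + ‖f p' - f z'‖ₑ := by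
    rw [← enorm_neg (f p' - f z'), neg_sub]
    refine le_trans (le_of_eq ?_) ((enorm_add_le _ _).trans
      (add_le_add_left (enorm_add_le _ _) _))
    congr 1; ring
  -- The factor 2 comes from the chain; each endpoint adds one more sum in passing to the net.
  calc ‖f p - f p'‖ₑ ≤ ∑ z ∈ Z, w z + 2 * ∑ z ∈ Z, w z + ∑ z ∈ Z, w z :=
        htri.trans (by gcongr)
    _ = 4 * ∑ z ∈ Z, w z := by ring
    _ ≤ 4 * (ENNReal.ofReal C * (17 ^ n * ∫⁻ x in S, ‖g x‖ₑ)) := by gcongr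
    _ = _ := by
        rw [show (4 : ℝ≥0∞) = ENNReal.ofReal 4 by simp,
          show (17 : ℝ≥0∞) ^ n = ENNReal.ofReal (17 ^ n) by
            rw [ENNReal.ofReal_pow (by norm_num)]; simp]
        simp only [← mul_assoc]
        rw [← ENNReal.ofReal_mul (by positivity), ← ENNReal.ofReal_mul (by positivity)]
        congr 2
        rw [hC]; ring

end Chaining

/-! ### Lebesgue points from summable oscillations. -/

section LebesguePoints

variable {n : ℕ} {D : Set (EuclideanSpace ℝ (Fin n))} {u : EuclideanSpace ℝ (Fin n) → ℝ}
  {g : EuclideanSpace ℝ (Fin n) → EuclideanSpace ℝ (Fin n)}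

/-- Passes from dyadic to arbitrary radii: |u - c| is split through the average over the ball of
radius 2t, and B(x, r) has volume at least that of B(x, t). -/
theorem HasWeakGradientOn.average_abs_sub_le (h : HasWeakGradientOn D u g)
    {x : EuclideanSpace ℝ (Fin n)} {t r : ℝ} (ht : 0 < t) (hD : closedBall x (4 * t) ⊆ D)
    (htr : t ≤ r) (hrt : r ≤ 2 * t) (c : ℝ) :
    ‖⨍ y in ball x r, |u y - c|‖ₑ
      ≤ ENNReal.ofReal (2 ^ (n + 2) / unitBallVolume n) * (ENNReal.ofReal (t / t ^ n)
          * ∫⁻ y in ball x (4 * t), ‖g y‖ₑ)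
        + 2 ^ n * ‖(⨍ y in ball x (2 * t), u y) - c‖ₑ := by
  have hω := unitBallVolume_pos n
  have hr : 0 < r := ht.trans_le htr
  set b := ⨍ y in ball x (2 * t), u y with hb
  have hu_int : IntegrableOn u (ball x r) :=
    (h.1.integrableOn_compact_subset hD (isCompact_closedBall _ _)).mono_set
      ((ball_subset_ball (by linarith)).trans ball_subset_closedBall)
  have hosc := h.lintegral_enorm_sub_average_le (z := x) (p := x) (r := 2 * t) (r' := 4 * t)
    (ρ := 2 * t) (by positivity) (by linarith) hD subset_rfl
  rw [← hb] at hosc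
  have hfin : IsFiniteMeasure (volume.restrict (ball x r)) :=
    ⟨by simpa using measure_ball_lt_top⟩
  have h1 := enorm_average_sub_le (μ := volume) (f := fun y => |u y - c|) (A := ball x r)
    (measure_ball_pos _ _ hr).ne' measure_ball_lt_top.ne
    ((hu_int.sub (integrable_const c)).abs) 0
  simp only [sub_zero] at h1
  refine h1.trans ?_
  have h2 : ∫⁻ y in ball x r, ‖|u y - c|‖ₑ
      ≤ (∫⁻ y in ball x (2 * t), ‖u y - b‖ₑ) + volume (ball x (2 * t)) * ‖b - c‖ₑ := by
    calc ∫⁻ y in ball x r, ‖|u y - c|‖ₑ ≤ ∫⁻ y in ball x (2 * t), ‖|u y - c|‖ₑ :=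
          lintegral_mono_set (ball_subset_ball hrt)
      _ ≤ ∫⁻ y in ball x (2 * t), (‖u y - b‖ₑ + ‖b - c‖ₑ) := by
          refine lintegral_mono fun y => ?_
          rw [← Real.norm_eq_abs, enorm_norm]
          refine le_trans (le_of_eq ?_) (enorm_add_le _ _)
          congr 1; ring
      _ = _ := by
          rw [lintegral_add_right _ measurable_const, setLIntegral_const, mul_comm ‖b - c‖ₑ]
  calc (volume (ball x r))⁻¹ * ∫⁻ y in ball x r, ‖|u y - c|‖ₑ
      ≤ (volume (ball x t))⁻¹ * (ENNReal.ofReal (2 ^ (n + 1) * (2 * t) ^ (n + 1) / (2 * t) ^ n)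
          * (∫⁻ y in ball x (4 * t), ‖g y‖ₑ) + volume (ball x (2 * t)) * ‖b - c‖ₑ) := by
        gcongr
        exact h2.trans (add_le_add_left hosc _)
    _ = _ := by
        rw [volume_ball_eq x ht, volume_ball_eq x (by positivity),
          ← ENNReal.ofReal_inv_of_pos (by positivity), mul_add, ← mul_assoc, ← mul_assoc,
          ← mul_assoc, ← ENNReal.ofReal_mul (by positivity), ← ENNReal.ofReal_mul (by positivity),
          ← ENNReal.ofReal_mul (by positivity),
          show (2 : ℝ≥0∞) ^ n = ENNReal.ofReal (2 ^ n) by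
            rw [ENNReal.ofReal_pow (by norm_num)]; simp]
        congr 3
        · rw [pow_succ (2 * t)]
          field_simp
          ring
        · rw [mul_pow]
          field_simp

/-- Convergence of averages and the Lebesgue point property, under a summability condition on the
gradient over dyadic balls. -/
theorem HasWeakGradientOn.exists_tendsto_average (h : HasWeakGradientOn D u g)
    {x : EuclideanSpace ℝ (Fin n)} {β : ℝ} (hβ : 0 < β) {m : ℕ → ℝ≥0∞} {J₀ : ℕ}
    (hD : ∀ j, J₀ ≤ j → closedBall x (4 * (β * (1 / 2) ^ j)) ⊆ D)
    (hm : ∀ j, J₀ ≤ j → ∫⁻ y in ball x (4 * (β * (1 / 2) ^ j)), ‖g y‖ₑ ≤ m j)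
    (hsum : ∑' j, ENNReal.ofReal ((β * (1 / 2) ^ j) / (β * (1 / 2) ^ j) ^ n) * m j ≠ ⊤) :
    ∃ c : ℝ, Tendsto (fun j : ℕ => ⨍ y in ball x (2 * (β * (1 / 2) ^ j)), u y) atTop (𝓝 c) ∧
      Tendsto (fun r : ℝ => ⨍ y in ball x r, |u y - c|) (𝓝[>] 0) (𝓝 0) := by
  set t : ℕ → ℝ := fun j => β * (1 / 2) ^ j with ht
  have htpos : ∀ j, 0 < t j := fun j => by positivity
  have htsucc : ∀ j, t j = 2 * t (j + 1) := fun j => by simp only [ht, pow_succ]; ring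
  set e : ℕ → ℝ≥0∞ := fun j => ENNReal.ofReal (t j / t j ^ n) * m j with he
  have hω := unitBallVolume_pos n
  set b : ℕ → ℝ := fun j => ⨍ y in ball x (2 * t j), u y with hb
  set C := 2 ^ (n + 1) / unitBallVolume n * 2 ^ (n + 1) with hC
  have hC0 : 0 ≤ C := by positivity
  have hstep : ∀ j, J₀ ≤ j → edist (b j) (b (j + 1)) ≤ ENNReal.ofReal C * e j := by
    intro j hj
    have h1 := h.enorm_average_sub_average_le (z := x) (p := x) (p' := x) (ρ := 2 * t j)
      (ρ' := 2 * t (j + 1)) (r := 2 * t j) (r' := 4 * t j) (by linarith [htpos j])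
      (by linarith [htpos (j + 1)]) (by linarith [htpos j]) (hD j hj) subset_rfl
      (ball_subset_ball (by linarith [htpos j, htsucc j]))
    rw [edist_eq_enorm_sub]
    refine h1.trans ?_
    change _ ≤ ENNReal.ofReal C * (ENNReal.ofReal (t j / t j ^ n) * m j)
    rw [← mul_assoc (ENNReal.ofReal C), ← ENNReal.ofReal_mul hC0]
    have ht0 := htpos j
    refine mul_le_mul' (ENNReal.ofReal_le_ofReal ?_) (hm j hj)
    rw [← htsucc, hC, mul_assoc]
    refine mul_le_mul_of_nonneg_left ?_ (by positivity)
    rw [pow_succ (2 * t j), show (2 * t j) ^ n * (2 * t j) / ((2 * t j) ^ n * t j ^ n)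
      = 2 * (t j / t j ^ n) by field_simp]
    gcongr
    exact le_self_pow₀ (by norm_num) (by omega)
  have hsumC : ∑' j, ENNReal.ofReal C * e (j + J₀) ≠ ⊤ := by
    rw [ENNReal.tsum_mul_left]
    refine ENNReal.mul_ne_top ENNReal.ofReal_ne_top (ne_top_of_le_ne_top hsum ?_)
    exact ENNReal.tsum_comp_le_tsum_of_injective (add_left_injective J₀) e
  have hcau : CauchySeq fun j => b (j + J₀) :=
    cauchySeq_of_edist_le_of_tsum_ne_top (fun j => ENNReal.ofReal C * e (j + J₀))
      (fun j => by
        have := hstep (j + J₀) (by omega)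
        rwa [show j + J₀ + 1 = j.succ + J₀ by omega] at this) hsumC
  obtain ⟨c, hc⟩ := cauchySeq_tendsto_of_complete hcau
  have hbc : Tendsto b atTop (𝓝 c) := (tendsto_add_atTop_iff_nat J₀).1 hc
  refine ⟨c, hbc, ?_⟩
  have hbe : Tendsto (fun j => ENNReal.ofReal (2 ^ (n + 2) / unitBallVolume n) * e j
      + 2 ^ n * ‖b j - c‖ₑ) atTop (𝓝 0) := by
    have h1 := ENNReal.Tendsto.const_mul (a := ENNReal.ofReal (2 ^ (n + 2) / unitBallVolume n))
      (ENNReal.tendsto_atTop_zero_of_tsum_ne_top hsum) (Or.inr ENNReal.ofReal_ne_top)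
    have h2 : Tendsto (fun j => ‖b j - c‖ₑ) atTop (𝓝 0) := by
      have := (hbc.sub_const c).enorm
      simpa using this
    have h3 := ENNReal.Tendsto.const_mul (a := (2 : ℝ≥0∞) ^ n) h2 (Or.inr (by finiteness))
    simpa using h1.add h3
  rw [Metric.tendsto_nhds]
  intro ε hε
  have hev := (hbe.eventually_lt_const (ENNReal.ofReal_pos.2 hε)).and (eventually_ge_atTop J₀)
  obtain ⟨J, hJ⟩ := eventually_atTop.1 hev
  have hpos : 0 < 2 * t J := by linarith [htpos J]
  filter_upwards [Ioo_mem_nhdsGT hpos] with r hr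
  -- The index is chosen so that t (J + k) ≤ r ≤ 2 t (J + k).
  obtain ⟨k, hk1, hk2⟩ := exists_nat_pow_near_of_lt_one (div_pos hr.1 hpos)
    ((div_le_one hpos).2 hr.2.le) (show (0 : ℝ) < 1 / 2 by norm_num) (by norm_num)
  have htk : t (J + k) = t J * (1 / 2) ^ k := by simp only [ht, pow_add]; ring
  rw [lt_div_iff₀ hpos, pow_succ] at hk1
  rw [div_le_iff₀ hpos] at hk2
  obtain ⟨hlt, hge⟩ := hJ (J + k) (by omega)
  have hav := h.average_abs_sub_le (htpos (J + k)) (hD _ hge) (r := r)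
    (by rw [htk]; linarith) (by rw [htk]; linarith) c
  have hfin : ‖⨍ y in ball x r, |u y - c|‖ₑ < ENNReal.ofReal ε := by
    refine lt_of_le_of_lt (hav.trans ?_) hlt
    exact add_le_add_left (mul_le_mul_right (mul_le_mul_right (hm _ hge) _) _) _
  rw [dist_zero_right]
  rw [← ofReal_norm] at hfin
  exact (ENNReal.ofReal_lt_ofReal_iff hε).1 hfin

end LebesguePoints

/-! ### Geometry of John domains and the chain to the center. -/

section JohnChain

variable {n : ℕ} {D : Set (EuclideanSpace ℝ (Fin n))} {u : EuclideanSpace ℝ (Fin n) → ℝ}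
  {g : EuclideanSpace ℝ (Fin n) → EuclideanSpace ℝ (Fin n)}

/-- A ball is connected; if it meets D and misses the frontier, it stays in D. -/
theorem ball_infDist_frontier_subset (hDo : IsOpen D) {x : EuclideanSpace ℝ (Fin n)} (hx : x ∈ D) :
    ball x (infDist x (frontier D)) ⊆ D := by
  set B := ball x (infDist x (frontier D)) with hB
  rcases (infDist_nonneg (x := x) (s := frontier D)).eq_or_lt with h0 | hpos
  · simp [hB, ← h0]
  have hBp : IsPreconnected B := (convex_ball _ _).isPreconnected
  have hdisj : ∀ y ∈ B, y ∉ frontier D := by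
    intro y hy hyf
    have h1 := infDist_le_dist_of_mem (x := x) hyf
    rw [hB, mem_ball, dist_comm] at hy
    linarith
  have hcov : B ⊆ D ∪ (closure D)ᶜ := by
    intro y hy
    by_cases hyD : y ∈ D
    · exact Or.inl hyD
    · refine Or.inr fun hyc => hdisj y hy ?_
      rw [frontier, hDo.interior_eq]
      exact ⟨hyc, hyD⟩
  refine hBp.subset_left_of_subset_union hDo isClosed_closure.isOpen_compl ?_ hcov
    ⟨x, mem_ball_self hpos, hx⟩
  exact disjoint_compl_right_iff_subset.2 subset_closure

theorem closedBall_subset_of_lt_infDist (hDo : IsOpen D) {x : EuclideanSpace ℝ (Fin n)} (hx : x ∈ D)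
    {r : ℝ} (hr : r < infDist x (frontier D)) : closedBall x r ⊆ D :=
  (closedBall_subset_ball hr).trans (ball_infDist_frontier_subset hDo hx)

/-- `infDist` to the empty set is 0 by convention, so the frontier must be shown nonempty: D is
bounded, hence not the whole space. -/
theorem infDist_frontier_pos (hn : 0 < n) (hDo : IsOpen D) (hDb : Bornology.IsBounded D)
    {x : EuclideanSpace ℝ (Fin n)} (hx : x ∈ D) : 0 < infDist x (frontier D) := by
  have : Nonempty (Fin n) := ⟨⟨0, hn⟩⟩
  have hne : (frontier D).Nonempty := by
    rw [nonempty_frontier_iff]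
    refine ⟨⟨x, hx⟩, fun h => ?_⟩
    rw [h] at hDb
    exact NormedSpace.unbounded_univ ℝ (EuclideanSpace ℝ (Fin n)) hDb
  rw [← isClosed_frontier.notMem_iff_infDist_pos hne, hDo.frontier_eq]
  exact fun h => h.2 hx

theorem HasUnitSpeedOn.dist_le {E : Type*} [PseudoMetricSpace E] {γ : ℝ → E} {S : Set ℝ}
    (h : HasUnitSpeedOn γ S) {a b : ℝ} (ha : a ∈ S) (hb : b ∈ S) (hab : a ≤ b) :
    dist (γ a) (γ b) ≤ b - a := by
  have h1 := h ha hb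
  have h2 := eVariationOn.edist_le γ (s := S ∩ Icc a b) ⟨ha, left_mem_Icc.2 hab⟩
    ⟨hb, right_mem_Icc.2 hab⟩
  rw [h1, edist_dist, NNReal.coe_one, one_mul,
    ENNReal.ofReal_le_ofReal_iff (by linarith)] at h2
  exact h2

theorem HasUnitSpeedOn.continuousOn {E : Type*} [PseudoMetricSpace E] {γ : ℝ → E} {S : Set ℝ}
    (h : HasUnitSpeedOn γ S) : ContinuousOn γ S := by
  have : LipschitzOnWith 1 γ S := LipschitzOnWith.of_dist_le_mul fun a ha b hb => by
    rw [NNReal.coe_one, one_mul]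
    rcases le_total a b with hab | hab
    · rw [Real.dist_eq, abs_sub_comm, abs_of_nonneg (by linarith)]
      exact h.dist_le ha hb hab
    · rw [dist_comm, Real.dist_eq, abs_of_nonneg (by linarith)]
      exact h.dist_le hb ha hab
  exact this.continuousOn

/-- The dyadic potential `∑ⱼ 2 ^ (j d) ∫_{B(x, A 2⁻ʲ) ∩ D} |g|`. -/
noncomputable def dyadicPotential (d A : ℝ) (D : Set (EuclideanSpace ℝ (Fin n)))
    (g : EuclideanSpace ℝ (Fin n) → EuclideanSpace ℝ (Fin n)) (x : EuclideanSpace ℝ (Fin n)) :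
    ℝ≥0∞ :=
  ∑' j : ℕ, ENNReal.ofReal (((2 : ℝ) ^ d) ^ j) * ∫⁻ y in ball x (A * (1 / 2) ^ j) ∩ D, ‖g y‖ₑ

/-- Throughout, `r / r ^ n` plays the role of r^(1-n) with natural exponents only. -/
theorem div_self_pow_anti (hn : 1 ≤ n) {r t : ℝ} (hr : 0 < r) (hrt : r ≤ t) :
    t / t ^ n ≤ r / r ^ n := by
  obtain ⟨k, rfl⟩ : ∃ k, n = k + 1 := ⟨n - 1, by omega⟩
  have ht : 0 < t := hr.trans_le hrt
  have e : ∀ a : ℝ, 0 < a → a / a ^ (k + 1) = (a ^ k)⁻¹ := fun a ha => by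
    rw [pow_succ]; field_simp
  rw [e t ht, e r hr]
  gcongr

theorem pow_succ_div_mul_pow (n : ℕ) {a b : ℝ} (ha : 0 < a) (hb : 0 < b) :
    a ^ (n + 1) / (a ^ n * (a * b) ^ n) = (b ^ n)⁻¹ * (a / a ^ n) := by
  rw [mul_pow, pow_succ]; field_simp

theorem enorm_sub_le_enorm_sub_add (a b c : ℝ) : ‖a - c‖ₑ ≤ ‖a - b‖ₑ + ‖b - c‖ₑ := by
  refine le_trans (le_of_eq ?_) (enorm_add_le _ _)
  congr 1; ring

/-- From the average over a small ball to the average over a large ball containing it. -/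
theorem HasWeakGradientOn.enorm_average_sub_average_le_of_dist_le (hn : 2 ≤ n)
    (h : HasWeakGradientOn D u g) {a x : EuclideanSpace ℝ (Fin n)} {r t : ℝ} (hr : 0 < r)
    (hrt : r ≤ t) (hax : dist a x ≤ t) (hD : closedBall x (4 * t) ⊆ D) :
    ‖(⨍ y in ball a r, u y) - ⨍ y in ball x (2 * t), u y‖ₑ
      ≤ ENNReal.ofReal ((2 * concentricConst n + concentricConst n) * (r / r ^ n))
        * ∫⁻ y in ball x (4 * t), ‖g y‖ₑ := by
  have ht : 0 < t := hr.trans_le hrt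
  have hω := unitBallVolume_pos n
  have hCc := concentricConst_pos n
  -- The small ball is enlarged concentrically until t/2 < 2^m r ≤ t; a single comparison with the
  -- ball around x then suffices.
  obtain ⟨m, hm1, hm2⟩ := exists_nat_pow_near ((one_le_div hr).2 hrt) (one_lt_two : (1 : ℝ) < 2)
  rw [le_div_iff₀ hr] at hm1
  rw [div_lt_iff₀ hr, pow_succ] at hm2
  have hρ : 0 < 2 ^ m * r := by positivity
  have e1 := h.enorm_average_sub_average_concentric_le hn a m hr (r' := 2 * t) (by linarith)
    ((closedBall_subset_closedBall' (by linarith)).trans hD)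
  have e2 := h.enorm_average_sub_average_le (z := x) (p := a) (p' := x) (ρ := 2 ^ m * r)
    (ρ' := 2 * t) (r := 2 * t) (r' := 4 * t) hρ (by positivity) (by linarith) hD
    (ball_subset_ball' (by linarith)) subset_rfl
  refine (enorm_sub_le_enorm_sub_add _ (⨍ y in ball a (2 ^ m * r), u y) _).trans
    ((add_le_add e1 e2).trans ?_)
  rw [add_mul, ENNReal.ofReal_add (by positivity) (by positivity), add_mul]
  refine add_le_add (mul_le_mul_right (lintegral_mono_set (ball_subset_ball' (by linarith))) _)
    (mul_le_mul_left (ENNReal.ofReal_le_ofReal ?_) _)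
  rw [concentricConst, mul_assoc]
  refine mul_le_mul_of_nonneg_left ?_ (by positivity)
  calc (2 * t) ^ (n + 1) / ((2 ^ m * r) ^ n * (2 * t) ^ n) = 2 * t / (2 ^ m * r) ^ n := by
        rw [pow_succ (2 * t)]; field_simp
    _ ≤ 2 * t / (t / 2) ^ n := by
        gcongr
        linarith
    _ = 2 ^ (n + 1) * (t / t ^ n) := by rw [div_pow, pow_succ]; field_simp
    _ ≤ _ := by
        exact mul_le_mul_of_nonneg_left (div_self_pow_anti (by omega) hr hrt) (by positivity)

/-- Chaining along a John curve: comparison of the average over a fixed ball at the John center with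
the average over a ball centred at `x`. -/
theorem IsJohnDomainWithCenter.exists_chain (hn : 2 ≤ n) {s : ℝ} (hs : 1 ≤ s)
    {x₀ : EuclideanSpace ℝ (Fin n)} (hJ : IsJohnDomainWithCenter s D x₀) :
    ∃ β c C : ℝ, 0 < β ∧ 0 < c ∧ 4 * c < infDist x₀ (frontier D) ∧ 0 < C ∧
      ∀ (u : EuclideanSpace ℝ (Fin n) → ℝ)
        (g : EuclideanSpace ℝ (Fin n) → EuclideanSpace ℝ (Fin n)), HasWeakGradientOn D u g →
        ∀ x ∈ D, ∀ J : ℕ, closedBall x (4 * (β * (1 / 2) ^ J)) ⊆ D →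
          ‖(⨍ y in ball x₀ c, u y) - ⨍ y in ball x (2 * (β * (1 / 2) ^ J)), u y‖ₑ
            ≤ ENNReal.ofReal C * dyadicPotential (s * (n - 1)) (8 * β) D g x := by
  obtain ⟨hDo, -, hDb, hx₀, α, β, hα, hαβ, hcurve⟩ := hJ
  have hβ : 0 < β := hα.trans_le hαβ
  have hδ := infDist_frontier_pos (by omega) hDo hDb hx₀
  have hω := unitBallVolume_pos n
  have hCc := concentricConst_pos n
  -- Halving the arc length t multiplies t^s by σ, so the radii will be r j = c σ^j, and r_j^(1-n)
  -- grows like L^j with L = 2^(s(n-1)).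
  set σ : ℝ := (1 / 2) ^ s with hσ
  have hσ0 : 0 < σ := by positivity
  have hσ2 : σ ≤ 1 / 2 := by
    have := Real.rpow_le_rpow_of_exponent_ge (x := 1 / 2) (by norm_num) (by norm_num) hs
    rwa [Real.rpow_one] at this
  set L : ℝ := (2 : ℝ) ^ (s * ((n : ℝ) - 1)) with hL
  have hL0 : 0 < L := by positivity
  have hσL : σ / σ ^ n = L := by
    rw [hσ, hL, one_div, Real.inv_rpow (by norm_num), ← Real.rpow_neg (by norm_num),
      ← Real.rpow_natCast, ← Real.rpow_mul (by norm_num), ← Real.rpow_sub (by norm_num)]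
    congr 1; ring
  set κ : ℝ := α / β * (β ^ s * σ) with hκ
  have hκ0 : 0 < κ := by positivity
  -- The bound by β gives r j ≤ t j. The other two keep the fourfold balls in D, at the center and
  -- along the curve; κ σ^j is the John lower bound for the distance at arc length t (j + 1).
  obtain ⟨c, hc0, hcβ, hcδ, hcκ⟩ : ∃ c : ℝ, 0 < c ∧ c ≤ β ∧ 4 * c < infDist x₀ (frontier D) ∧
      4 * c < κ := by
    refine ⟨min β (min (infDist x₀ (frontier D) / 5) (κ / 5)), by positivity, min_le_left _ _,
      ?_, ?_⟩
    · have : min β (min (infDist x₀ (frontier D) / 5) (κ / 5)) ≤ infDist x₀ (frontier D) / 5 :=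
        (min_le_right _ _).trans (min_le_left _ _)
      linarith
    · have : min β (min (infDist x₀ (frontier D) / 5) (κ / 5)) ≤ κ / 5 :=
        (min_le_right _ _).trans (min_le_right _ _)
      linarith
  set C₁ := 4 * (2 ^ (n + 1) / unitBallVolume n * 3 ^ (n + 1)) * 17 ^ n with hC₁
  set C₂ := 2 ^ (n + 1) / unitBallVolume n * (σ ^ n)⁻¹ with hC₂
  set C₃ := 2 * concentricConst n + concentricConst n with hC₃
  have hC₁0 : 0 < C₁ := by positivity
  have hC₂0 : 0 < C₂ := by positivity
  have hC₃0 : 0 < C₃ := by positivity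
  refine ⟨β, c, (C₁ + C₂ + C₃) * (c / c ^ n), hβ, hc0, hcδ, by positivity, ?_⟩
  intro u g h x hx J hxJ
  obtain ⟨ℓ, γ, hℓ0, hℓβ, hγ, hγD, hγ0, hγℓ, hγdist⟩ := hcurve x hx
  set t : ℕ → ℝ := fun j => β * (1 / 2) ^ j with ht
  set r : ℕ → ℝ := fun j => c * σ ^ j with hr
  have htpos : ∀ j, 0 < t j := fun j => by positivity
  have hrpos : ∀ j, 0 < r j := fun j => by positivity
  have htsucc : ∀ j, t j = 2 * t (j + 1) := fun j => by simp only [ht, pow_succ]; ring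
  have hrt : ∀ j, r j ≤ t j := fun j => by
    simp only [ht, hr]
    gcongr
  have hrn : ∀ j, r j / r j ^ n = c / c ^ n * L ^ j := fun j => by
    simp only [hr]
    rw [← hσL, div_pow, mul_pow, ← pow_mul, ← pow_mul, mul_comm n j, mul_div_mul_comm]
  have hts : ∀ j, t j ^ s = β ^ s * σ ^ j := fun j => by
    simp only [ht]
    rw [Real.mul_rpow hβ.le (by positivity), hσ, ← Real.rpow_natCast, ← Real.rpow_natCast,
      ← Real.rpow_mul (by norm_num), ← Real.rpow_mul (by norm_num), mul_comm (j : ℝ)]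
  -- The curve may be shorter than t j. As t 0 = β ≥ ℓ, the chain starts at τ 0 = ℓ, that is, at x₀.
  set τ : ℕ → ℝ := fun j => min (t j) ℓ with hτ
  have hτ0 : ∀ j, 0 ≤ τ j := fun j => le_min (htpos j).le hℓ0
  have hτt : ∀ j, τ j ≤ t j := fun j => min_le_left _ _
  have hτℓ : ∀ j, τ j ≤ ℓ := fun j => min_le_right _ _
  have hτmono : ∀ j, τ (j + 1) ≤ τ j := fun j =>
    min_le_min_right _ (by linarith [htsucc j, htpos (j + 1)])
  have hτ00 : τ 0 = ℓ := by simp [hτ, ht, hℓβ]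
  set S : ℕ → Set (EuclideanSpace ℝ (Fin n)) := fun j => ball x (8 * t j) ∩ D with hS
  have hpot : dyadicPotential (s * ((n : ℝ) - 1)) (8 * β) D g x
      = ∑' j, ENNReal.ofReal (L ^ j) * ∫⁻ y in S j, ‖g y‖ₑ := by
    simp only [dyadicPotential, hS, ht, hL, mul_assoc]
  set M : ℕ → ℝ≥0∞ := fun j => ENNReal.ofReal (L ^ j) * ∫⁻ y in S j, ‖g y‖ₑ with hM
  have hMmul : ∀ {a : ℝ}, 0 ≤ a → ∀ j, ENNReal.ofReal a * M j
      = ENNReal.ofReal (a * L ^ j) * ∫⁻ y in S j, ‖g y‖ₑ := fun ha j => by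
    rw [ENNReal.ofReal_mul ha, mul_assoc]
  have hdistx : ∀ j, ∀ v ∈ Icc 0 (τ j), dist (γ v) x ≤ t j := by
    intro j v hv
    rw [← hγ0, dist_comm]
    have := hγ.dist_le (a := 0) (b := v) ⟨le_rfl, hℓ0⟩ ⟨hv.1, hv.2.trans (hτℓ j)⟩ hv.1
    linarith [hv.2, hτt j]
  have hballD : ∀ j, ∀ v ∈ Icc (τ (j + 1)) (τ j), closedBall (γ v) (4 * r j) ⊆ D := by
    intro j v hv
    have hvI : v ∈ Icc 0 ℓ := ⟨(hτ0 _).trans hv.1, hv.2.trans (hτℓ j)⟩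
    refine closedBall_subset_of_lt_infDist hDo (hγD hvI) ?_
    rcases le_total (t (j + 1)) ℓ with hcase | hcase
    · have hv1 : t (j + 1) ≤ v := by
        have := hv.1
        simpa only [hτ, min_eq_left hcase] using this
      have h1 := hγdist v hvI
      have h2 : t (j + 1) ^ s ≤ v ^ s := Real.rpow_le_rpow (htpos _).le hv1 (by linarith)
      rw [hts, pow_succ] at h2
      have h3 : α / β * (β ^ s * (σ ^ j * σ)) ≤ infDist (γ v) (frontier D) := by
        calc _ ≤ α / β * (β / α * infDist (γ v) (frontier D)) := by
              exact mul_le_mul_of_nonneg_left (h2.trans h1) (by positivity)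
          _ = _ := by field_simp
      refine lt_of_lt_of_le ?_ h3
      calc 4 * r j = 4 * c * σ ^ j := by simp only [hr]; ring
        _ < κ * σ ^ j := by gcongr
        _ = _ := by rw [hκ]; ring
    -- Here the piece of curve degenerates to the single point x₀.
    · have hv1 : v = ℓ := by
        apply le_antisymm hvI.2
        have := hv.1
        simpa only [hτ, min_eq_right hcase] using this
      rw [hv1, hγℓ]
      refine lt_of_le_of_lt ?_ hcδ
      have : σ ^ j ≤ 1 := pow_le_one₀ hσ0.le (by linarith)
      simp only [hr]
      nlinarith
  have hballS : ∀ j, ∀ v ∈ Icc (τ (j + 1)) (τ j), ball (γ v) (4 * r j) ⊆ S j := by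
    intro j v hv
    refine subset_inter (ball_subset_ball' ?_) (ball_subset_closedBall.trans (hballD j v hv))
    linarith [hdistx j v ⟨(hτ0 _).trans hv.1, hv.2⟩, hrt j, htpos j]
  have hstep : ∀ j, ‖(⨍ y in ball (γ (τ j)) (r j), u y)
      - ⨍ y in ball (γ (τ (j + 1))) (r (j + 1)), u y‖ₑ
      ≤ ENNReal.ofReal ((C₁ + C₂) * (c / c ^ n)) * M j := by
    intro j
    have hmem1 : τ j ∈ Icc (τ (j + 1)) (τ j) := ⟨hτmono j, le_rfl⟩
    have hmem2 : τ (j + 1) ∈ Icc (τ (j + 1)) (τ j) := ⟨le_rfl, hτmono j⟩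
    have hcont : ContinuousOn γ (Icc (τ (j + 1)) (τ j)) :=
      hγ.continuousOn.mono (Icc_subset_Icc (hτ0 _) (hτℓ _))
    -- The ball slides along the curve at fixed radius r j (`e1`), then shrinks to radius r (j + 1)
    -- at the new center (`e2`).
    have e1 := h.enorm_average_sub_average_le_of_isPreconnected (r := r j) (S := S j)
      (isPreconnected_Icc.image γ hcont) (isCompact_Icc.image_of_continuousOn hcont) (hrpos j)
      (by rintro _ ⟨v, hv, rfl⟩; exact hballD j v hv) inter_subset_right
      (by rintro _ ⟨v, hv, rfl⟩; exact hballS j v hv)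
      (mem_image_of_mem γ hmem1) (mem_image_of_mem γ hmem2)
    have hrs : r (j + 1) = r j * σ := by simp only [hr, pow_succ]; ring
    have e2 := h.enorm_average_sub_average_le (z := γ (τ (j + 1))) (p := γ (τ (j + 1)))
      (p' := γ (τ (j + 1))) (ρ := r j) (ρ' := r (j + 1)) (r := r j) (r' := 4 * r j)
      (hrpos j) (hrpos _) (by linarith [hrpos j]) (hballD j _ hmem2) subset_rfl
      (ball_subset_ball (by rw [hrs]; nlinarith [hrpos j]))
    refine (enorm_sub_le_enorm_sub_add _ (⨍ y in ball (γ (τ (j + 1))) (r j), u y) _).trans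
      ((add_le_add e1 (e2.trans (mul_le_mul_right
        (lintegral_mono_set (hballS j _ hmem2)) _))).trans (le_of_eq ?_))
    have hrj := hrpos j
    rw [← add_mul, ← ENNReal.ofReal_add (by positivity)
      (by have := hrpos (j + 1); positivity), hMmul (by positivity)]
    congr 2
    rw [mul_assoc (C₁ + C₂), ← hrn, hrs, pow_succ_div_mul_pow _ (hrpos j) hσ0, hC₂, hC₁]
    ring
  have htele : ∀ J, ‖(⨍ y in ball (γ (τ 0)) (r 0), u y) - ⨍ y in ball (γ (τ J)) (r J), u y‖ₑ
      ≤ ENNReal.ofReal ((C₁ + C₂) * (c / c ^ n)) * ∑ j ∈ Finset.range J, M j := by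
    intro J
    induction J with
    | zero => simp
    | succ J ih =>
      rw [Finset.sum_range_succ, mul_add]
      exact (enorm_sub_le_enorm_sub_add _ _ _).trans (add_le_add ih (hstep J))
  have hlast : ‖(⨍ y in ball (γ (τ J)) (r J), u y) - ⨍ y in ball x (2 * t J), u y‖ₑ
      ≤ ENNReal.ofReal (C₃ * (c / c ^ n)) * M J := by
    have := h.enorm_average_sub_average_le_of_dist_le hn (hrpos J) (hrt J)
      (hdistx J (τ J) ⟨hτ0 J, le_rfl⟩) hxJ
    refine this.trans ?_
    rw [hMmul (by positivity), mul_assoc C₃, ← hrn]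
    refine mul_le_mul_right (lintegral_mono_set (subset_inter ?_ ?_)) _
    · exact ball_subset_ball (by linarith [htpos J])
    · exact ball_subset_closedBall.trans hxJ
  have hfirst : ball (γ (τ 0)) (r 0) = ball x₀ c := by rw [hτ00, hγℓ]; simp [hr]
  rw [hpot, ← hfirst]
  refine (enorm_sub_le_enorm_sub_add _ _ _).trans ((add_le_add (htele J) hlast).trans ?_)
  rw [add_mul (C₁ + C₂), ENNReal.ofReal_add (by positivity) (by positivity),
    add_mul (ENNReal.ofReal _)]
  exact add_le_add (mul_le_mul_right (ENNReal.sum_le_tsum _) _)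
    (mul_le_mul_right (ENNReal.le_tsum J) _)

end JohnChain

/-! ### Pointwise bound by the potential. -/

section JohnPointwise

variable {n : ℕ} {D : Set (EuclideanSpace ℝ (Fin n))} {u : EuclideanSpace ℝ (Fin n) → ℝ}
  {g : EuclideanSpace ℝ (Fin n) → EuclideanSpace ℝ (Fin n)}

/-- Points where the dyadic potential of the gradient is finite are Lebesgue points, and the
oscillation there is controlled by the potential. -/
theorem IsJohnDomainWithCenter.exists_pointwise (hn : 2 ≤ n) {s : ℝ} (hs : 1 ≤ s)
    {x₀ : EuclideanSpace ℝ (Fin n)} (hJ : IsJohnDomainWithCenter s D x₀) :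
    ∃ A c C : ℝ, 0 < A ∧ 0 < c ∧ 4 * c < infDist x₀ (frontier D) ∧ 0 < C ∧
      ∀ (u : EuclideanSpace ℝ (Fin n) → ℝ)
        (g : EuclideanSpace ℝ (Fin n) → EuclideanSpace ℝ (Fin n)), HasWeakGradientOn D u g →
        ∀ x ∈ D, dyadicPotential (s * (n - 1)) A D g x ≠ ⊤ → ∃ b : ℝ,
          Tendsto (fun r : ℝ => ⨍ y in ball x r, |u y - b|) (𝓝[>] 0) (𝓝 0) ∧
          ‖b - ⨍ y in ball x₀ c, u y‖ₑ
            ≤ ENNReal.ofReal C * dyadicPotential (s * (n - 1)) A D g x := by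
  obtain ⟨β, c, C, hβ, hc, hcδ, hC, hchain⟩ := hJ.exists_chain hn hs
  obtain ⟨hDo, -, hDb, -⟩ := hJ
  refine ⟨8 * β, c, C, by positivity, hc, hcδ, hC, ?_⟩
  intro u g h x hx hfin
  have hδ := infDist_frontier_pos (by omega) hDo hDb hx
  obtain ⟨J₀, hJ₀⟩ := exists_pow_lt_of_lt_one (show 0 < infDist x (frontier D) / (4 * β) by
    positivity) (show (1 / 2 : ℝ) < 1 by norm_num)
  rw [lt_div_iff₀ (by positivity)] at hJ₀
  have hD : ∀ j, J₀ ≤ j → closedBall x (4 * (β * (1 / 2) ^ j)) ⊆ D := by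
    intro j hj
    refine closedBall_subset_of_lt_infDist hDo hx (lt_of_le_of_lt ?_ hJ₀)
    have : (1 / 2 : ℝ) ^ j ≤ (1 / 2) ^ J₀ :=
      pow_le_pow_of_le_one (by norm_num) (by norm_num) hj
    nlinarith
  set L : ℝ := (2 : ℝ) ^ (s * ((n : ℝ) - 1)) with hL
  -- Since s ≥ 1, the weights 2^(j(n-1)) in the Lebesgue point criterion are dominated by the
  -- weights L^j of the potential.
  have hhalf : (1 / 2 : ℝ) / (1 / 2) ^ n ≤ L := by
    have h1 : (1 / 2 : ℝ) / (1 / 2) ^ n = (2 : ℝ) ^ ((n : ℝ) - 1) := by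
      rw [Real.rpow_sub (by norm_num), Real.rpow_natCast, Real.rpow_one, one_div, inv_pow]
      field_simp
    rw [h1, hL]
    refine Real.rpow_le_rpow_of_exponent_le (by norm_num) ?_
    have : (2 : ℝ) ≤ n := by exact_mod_cast hn
    nlinarith
  obtain ⟨b, hb, hleb⟩ := h.exists_tendsto_average hβ (x := x)
    (m := fun j => ∫⁻ y in ball x (8 * β * (1 / 2) ^ j) ∩ D, ‖g y‖ₑ) hD
    (fun j hj => lintegral_mono_set (subset_inter
      (ball_subset_ball (by
        have : 0 < β * (1 / 2 : ℝ) ^ j := by positivity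
        linarith)) (ball_subset_closedBall.trans (hD j hj))))
    (by
      refine ne_top_of_le_ne_top (ENNReal.mul_ne_top (ENNReal.ofReal_ne_top (r := β / β ^ n)) hfin)
        ?_
      rw [dyadicPotential, ← ENNReal.tsum_mul_left]
      refine ENNReal.tsum_le_tsum fun j => ?_
      rw [← mul_assoc, ← ENNReal.ofReal_mul (by positivity)]
      refine mul_le_mul_left (ENNReal.ofReal_le_ofReal ?_) _
      rw [mul_pow, ← pow_mul, mul_comm j n, pow_mul, mul_div_mul_comm, ← div_pow]
      gcongr)
  refine ⟨b, hleb, ?_⟩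
  -- The chain estimate does not depend on the final scale j, so it survives the limit.
  refine le_of_tendsto (hb.sub_const (⨍ y in ball x₀ c, u y)).enorm ?_
  filter_upwards [eventually_ge_atTop J₀] with j hj
  rw [← enorm_neg, neg_sub]
  exact hchain u g h x hx j (hD j hj)

/-- Integrability up to the boundary of the largest ball around a point. -/
theorem HasWeakGradientOn.integrableOn_ball_infDist (h : HasWeakGradientOn D u g) (hDo : IsOpen D)
    {x₀ : EuclideanSpace ℝ (Fin n)} (hx₀ : x₀ ∈ D) {c : ℝ} (hc : 0 < c)
    (hcδ : c < infDist x₀ (frontier D)) (hg : ∫⁻ y in D, ‖g y‖ₑ ≠ ⊤) :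
    IntegrableOn u (ball x₀ (infDist x₀ (frontier D))) ∧
      ‖(⨍ y in ball x₀ (infDist x₀ (frontier D)), u y) - ⨍ y in ball x₀ c, u y‖ₑ
        ≤ (volume (ball x₀ (infDist x₀ (frontier D))))⁻¹ *
          (ENNReal.ofReal (2 ^ (n + 1) * infDist x₀ (frontier D) ^ (n + 1) / c ^ n)
            * ∫⁻ y in D, ‖g y‖ₑ) := by
  set R := infDist x₀ (frontier D) with hR
  set b := ⨍ y in ball x₀ c, u y with hb
  have hR0 : 0 < R := hc.trans hcδ
  have hBD : ball x₀ R ⊆ D := ball_infDist_frontier_subset hDo hx₀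
  -- Poincaré needs a larger closed ball inside D, so radii below R come first; the bound is uniform
  -- and passes to R by monotone convergence.
  have hsmall : ∀ r, c ≤ r → r < R → ∫⁻ y in ball x₀ r, ‖u y - b‖ₑ
      ≤ ENNReal.ofReal (2 ^ (n + 1) * R ^ (n + 1) / c ^ n) * ∫⁻ y in D, ‖g y‖ₑ := by
    intro r hcr hrR
    obtain ⟨r', hr', hr'R⟩ := exists_between hrR
    have hsub : closedBall x₀ r' ⊆ D := (closedBall_subset_ball hr'R).trans hBD
    refine (h.lintegral_enorm_sub_average_le hc hr' hsub (ball_subset_ball hcr)).trans ?_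
    refine mul_le_mul' (ENNReal.ofReal_le_ofReal ?_)
      (lintegral_mono_set (ball_subset_closedBall.trans hsub))
    have : 0 ≤ r := hc.le.trans hcr
    gcongr
  obtain ⟨ρ, hρmono, hρlt, hρlim⟩ := exists_seq_strictMono_tendsto' hcδ
  have hunion : ball x₀ R = ⋃ k, ball x₀ (ρ k) := by
    refine Subset.antisymm (fun y hy => ?_)
      (iUnion_subset fun k => ball_subset_ball (hρlt k).2.le)
    rw [mem_ball] at hy
    obtain ⟨k, hk⟩ := (hρlim.eventually_const_lt hy).exists
    exact mem_iUnion.2 ⟨k, mem_ball.2 hk⟩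
  have hfull : ∫⁻ y in ball x₀ R, ‖u y - b‖ₑ
      ≤ ENNReal.ofReal (2 ^ (n + 1) * R ^ (n + 1) / c ^ n) * ∫⁻ y in D, ‖g y‖ₑ := by
    rw [hunion, setLIntegral_iUnion_of_directed _ (Monotone.directed_le fun i j hij =>
      ball_subset_ball (hρmono.monotone hij))]
    exact iSup_le fun k => hsmall _ (hρlt k).1.le (hρlt k).2
  have hfin : IsFiniteMeasure (volume.restrict (ball x₀ R)) :=
    ⟨by simpa using measure_ball_lt_top⟩
  have hmeas : AEStronglyMeasurable u (volume.restrict (ball x₀ R)) :=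
    h.1.aestronglyMeasurable.mono_measure (Measure.restrict_mono_set _ hBD)
  have hu_int : IntegrableOn u (ball x₀ R) := by
    have h1 : Integrable (fun y => u y - b) (volume.restrict (ball x₀ R)) :=
      ⟨hmeas.sub aestronglyMeasurable_const, lt_of_le_of_lt hfull
        (ENNReal.mul_lt_top ENNReal.ofReal_lt_top hg.lt_top)⟩
    have h2 := h1.add (integrable_const b)
    refine h2.congr (Eventually.of_forall fun y => ?_)
    simp
  refine ⟨hu_int, (enorm_average_sub_le (measure_ball_pos _ _ hR0).ne' measure_ball_lt_top.ne
    hu_int b).trans ?_⟩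
  gcongr

end JohnPointwise

/-! ### Hölder estimates for the dyadic potential. -/

section Potential

variable {n : ℕ} {D : Set (EuclideanSpace ℝ (Fin n))}
  {g : EuclideanSpace ℝ (Fin n) → EuclideanSpace ℝ (Fin n)}

theorem ENNReal.sum_range_succ_pow_le_two_mul {Λ : ℝ≥0∞} (hΛ : 2 ≤ Λ) (J : ℕ) :
    ∑ j ∈ Finset.range (J + 1), Λ ^ j ≤ 2 * Λ ^ J := by
  induction J with
  | zero => simp
  | succ J ih =>
    rw [Finset.sum_range_succ]
    calc _ ≤ 2 * Λ ^ J + Λ ^ (J + 1) := by gcongr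
      _ ≤ Λ * Λ ^ J + Λ ^ (J + 1) := by gcongr
      _ = 2 * Λ ^ (J + 1) := by ring

/-- The powers of a lacunary sum of indicators are controlled termwise. -/
theorem rpow_sum_indicator_le {α : Type*} {Λ : ℝ≥0∞} (hΛ : 2 ≤ Λ) {q : ℝ} (hq : 0 < q)
    (B : ℕ → Set α) (y : α) (J : ℕ) :
    (∑ j ∈ Finset.range J, (B j).indicator (fun _ => Λ ^ j) y) ^ q
      ≤ ∑ j ∈ Finset.range J, (B j).indicator (fun _ => 2 ^ q * (Λ ^ q) ^ j) y := by
  induction J with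
  | zero => simp [hq]
  | succ J ih =>
    -- If y lies in the last set, that term alone controls the whole geometric sum, up to a factor
    -- 2; otherwise the last term vanishes on both sides.
    by_cases hy : y ∈ B J
    · calc _ ≤ (∑ j ∈ Finset.range (J + 1), Λ ^ j) ^ q := by
            gcongr with j
            exact indicator_le_self' (fun _ _ => zero_le) y
        _ ≤ (2 * Λ ^ J) ^ q := by
            gcongr
            exact ENNReal.sum_range_succ_pow_le_two_mul hΛ J
        _ = (B J).indicator (fun _ => 2 ^ q * (Λ ^ q) ^ J) y := by
            rw [indicator_of_mem hy, ENNReal.mul_rpow_of_nonneg _ _ hq.le,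
              ← ENNReal.rpow_natCast_mul, ← ENNReal.rpow_mul_natCast, mul_comm q]
        _ ≤ _ := Finset.single_le_sum (f := fun j =>
            (B j).indicator (fun _ => 2 ^ q * (Λ ^ q) ^ j) y) (fun _ _ => zero_le)
            (Finset.self_mem_range_succ J)
    · rw [Finset.sum_range_succ, Finset.sum_range_succ, indicator_of_notMem hy,
        indicator_of_notMem hy, add_zero, add_zero]
      exact ih

theorem ofReal_two_rpow_mul_volume_ball {A : ℝ} (hA : 0 < A) (x : EuclideanSpace ℝ (Fin n)) (j : ℕ) :
    (2 ^ n : ℝ≥0∞) ^ j * volume (ball x (A * (1 / 2) ^ j))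
      = ENNReal.ofReal (A ^ n * unitBallVolume n) := by
  rw [volume_ball_eq x (by positivity), show (2 ^ n : ℝ≥0∞) ^ j = ENNReal.ofReal ((2 ^ n) ^ j) by
    rw [ENNReal.ofReal_pow (by positivity), ENNReal.ofReal_pow (by norm_num)]; simp,
    ← ENNReal.ofReal_mul (by positivity)]
  congr 1
  rw [mul_pow, ← pow_mul, ← pow_mul, mul_comm n j, one_div, inv_pow]
  field_simp

/-- Hölder's inequality for the first `J` terms of the dyadic potential. -/
theorem sum_range_dyadic_le {Λ : ℝ≥0∞} (hΛ : 2 ≤ Λ) {p q : ℝ}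
    (hpq : p.HolderConjugate q) (hΛq : Λ ^ q = 2 ^ n) {A : ℝ} (hA : 0 < A)
    (hgm : AEMeasurable (fun y => ‖g y‖ₑ) (volume.restrict D))
    (hg : ∫⁻ y in D, ‖g y‖ₑ ^ p ≤ 1) (x : EuclideanSpace ℝ (Fin n)) (J : ℕ) :
    ∑ j ∈ Finset.range J, Λ ^ j * ∫⁻ y in ball x (A * (1 / 2) ^ j) ∩ D, ‖g y‖ₑ
      ≤ (J * (2 ^ q * ENNReal.ofReal (A ^ n * unitBallVolume n))) ^ (1 / q) := by
  have hq0 : 0 < q := hpq.symm.pos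
  set B : ℕ → Set (EuclideanSpace ℝ (Fin n)) := fun j => ball x (A * (1 / 2) ^ j) with hB
  have hBm : ∀ j, MeasurableSet (B j) := fun j => measurableSet_ball
  -- The partial sum is one integral of |g| against this kernel. As Λ^q = 2^n, every scale
  -- contributes the same amount to the bound for ∫ K^q, hence the growth J^(1/q).
  set K : EuclideanSpace ℝ (Fin n) → ℝ≥0∞ := fun y =>
    ∑ j ∈ Finset.range J, (B j).indicator (fun _ => Λ ^ j) y with hK
  have hKm : Measurable K :=
    Finset.measurable_sum _ fun j _ => measurable_const.indicator (hBm j)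
  have h1 : ∑ j ∈ Finset.range J, Λ ^ j * ∫⁻ y in B j ∩ D, ‖g y‖ₑ
      = ∫⁻ y in D, (fun y => ‖g y‖ₑ) y * K y := by
    simp only [hK, Finset.mul_sum]
    rw [lintegral_finsetSum' (f := fun i y => ‖g y‖ₑ * (B i).indicator (fun _ => Λ ^ i) y) _
      fun j _ => hgm.mul (measurable_const.indicator (hBm j)).aemeasurable]
    refine Finset.sum_congr rfl fun j _ => ?_
    rw [← Measure.restrict_restrict (hBm j), ← lintegral_const_mul'' _ (hgm.mono_measure
      Measure.restrict_le_self), ← lintegral_indicator (hBm j)]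
    refine lintegral_congr fun y => ?_
    by_cases hy : y ∈ B j <;> simp [hy, mul_comm]
  have h2 : ∫⁻ y in D, K y ^ q ≤ J * (2 ^ q * ENNReal.ofReal (A ^ n * unitBallVolume n)) := by
    calc ∫⁻ y in D, K y ^ q ≤ ∫⁻ y, K y ^ q := setLIntegral_le_lintegral _ _
      _ ≤ ∫⁻ y, ∑ j ∈ Finset.range J, (B j).indicator (fun _ => 2 ^ q * (Λ ^ q) ^ j) y :=
          lintegral_mono fun y => rpow_sum_indicator_le hΛ hq0 B y J
      _ = ∑ j ∈ Finset.range J, ∫⁻ y, (B j).indicator (fun _ => 2 ^ q * (Λ ^ q) ^ j) y :=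
          lintegral_finsetSum _ fun j _ => measurable_const.indicator (hBm j)
      _ = ∑ j ∈ Finset.range J, 2 ^ q * ENNReal.ofReal (A ^ n * unitBallVolume n) := by
          refine Finset.sum_congr rfl fun j _ => ?_
          rw [lintegral_indicator (hBm j), setLIntegral_const, hΛq, mul_assoc,
            ofReal_two_rpow_mul_volume_ball hA]
      _ = _ := by rw [Finset.sum_const, Finset.card_range, nsmul_eq_mul]
  rw [h1]
  calc _ ≤ (∫⁻ y in D, ‖g y‖ₑ ^ p) ^ (1 / p) * (∫⁻ y in D, K y ^ q) ^ (1 / q) :=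
        ENNReal.lintegral_mul_le_Lp_mul_Lq _ hpq hgm hKm.aemeasurable
    _ ≤ 1 ^ (1 / p) * (J * (2 ^ q * ENNReal.ofReal (A ^ n * unitBallVolume n))) ^ (1 / q) := by
        have := hpq.pos
        gcongr
    _ = _ := by rw [ENNReal.one_rpow, one_mul]

/-- Hölder's inequality for a single term of the dyadic potential. -/
theorem dyadic_term_le {Λ : ℝ≥0∞} {p q : ℝ} (hpq : p.HolderConjugate q) (hΛq : Λ ^ q = 2 ^ n)
    {A : ℝ} (hA : 0 < A) (hgm : AEMeasurable (fun y => ‖g y‖ₑ) (volume.restrict D))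
    (x : EuclideanSpace ℝ (Fin n)) (j : ℕ) :
    Λ ^ j * ∫⁻ y in ball x (A * (1 / 2) ^ j) ∩ D, ‖g y‖ₑ
      ≤ ENNReal.ofReal (A ^ n * unitBallVolume n) ^ (1 / q)
        * (∫⁻ y in ball x (A * (1 / 2) ^ j) ∩ D, ‖g y‖ₑ ^ p) ^ (1 / p) := by
  have hq0 : 0 < q := hpq.symm.pos
  set S := ball x (A * (1 / 2) ^ j) ∩ D with hS
  have h1 : ∫⁻ y in S, ‖g y‖ₑ ≤ (∫⁻ y in S, ‖g y‖ₑ ^ p) ^ (1 / p)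
      * volume (ball x (A * (1 / 2) ^ j)) ^ (1 / q) := by
    have := ENNReal.lintegral_mul_le_Lp_mul_Lq (volume.restrict S) hpq
      (hgm.mono_measure (Measure.restrict_mono_set _ inter_subset_right))
      (aemeasurable_const (b := (1 : ℝ≥0∞)))
    simp only [Pi.mul_apply, mul_one, ENNReal.one_rpow, setLIntegral_const, one_mul] at this
    refine this.trans ?_
    gcongr
    exact inter_subset_left
  have h2 : Λ ^ j * volume (ball x (A * (1 / 2) ^ j)) ^ (1 / q)
      = ENNReal.ofReal (A ^ n * unitBallVolume n) ^ (1 / q) := by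
    rw [← ofReal_two_rpow_mul_volume_ball hA x j,
      ENNReal.mul_rpow_of_nonneg _ _ (by positivity), ← hΛq]
    congr 1
    rw [← ENNReal.rpow_mul_natCast, ← ENNReal.rpow_mul, mul_comm q, mul_assoc,
      mul_one_div_cancel hq0.ne', mul_one, ENNReal.rpow_natCast]
  calc _ ≤ Λ ^ j * ((∫⁻ y in S, ‖g y‖ₑ ^ p) ^ (1 / p)
      * volume (ball x (A * (1 / 2) ^ j)) ^ (1 / q)) := by gcongr
    _ = _ := by rw [← h2]; ring

/-- The dyadic potential is at most of order `J ^ (1 / q)` off the set where `|g| ^ p` concentrates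
at scales below `2 ^ (-J)`. -/
theorem exists_dyadicPotential_le (n : ℕ) {d p q A : ℝ} (hd : 1 ≤ d) (hpq : p.HolderConjugate q)
    (hdq : d * q = n) (hA : 0 < A) :
    ∃ C : ℝ, 0 < C ∧ ∀ (D : Set (EuclideanSpace ℝ (Fin n)))
      (g : EuclideanSpace ℝ (Fin n) → EuclideanSpace ℝ (Fin n)),
      AEMeasurable (fun y => ‖g y‖ₑ) (volume.restrict D) → ∫⁻ y in D, ‖g y‖ₑ ^ p ≤ 1 →
      ∀ (J : ℕ) (x : EuclideanSpace ℝ (Fin n)),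
        (∀ k : ℕ, ∫⁻ y in ball x (A * (1 / 2) ^ (J + k)) ∩ D, ‖g y‖ₑ ^ p
          ≤ (ENNReal.ofReal (2 ^ d))⁻¹ ^ k) →
        dyadicPotential d A D g x ≤ ENNReal.ofReal (C * ((J : ℝ) + 1) ^ (1 / q)) := by
  have hp0 : 0 < p := hpq.pos
  have hq0 : 0 < q := hpq.symm.pos
  have hω := unitBallVolume_pos n
  set Λ : ℝ≥0∞ := ENNReal.ofReal (2 ^ d) with hΛdef
  have hΛ : 2 ≤ Λ := by
    rw [hΛdef, show (2 : ℝ≥0∞) = ENNReal.ofReal 2 by simp]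
    apply ENNReal.ofReal_le_ofReal
    have := Real.rpow_le_rpow_of_exponent_le (x := 2) (by norm_num) hd
    rwa [Real.rpow_one] at this
  have hΛtop : Λ ≠ ⊤ := ENNReal.ofReal_ne_top
  have hΛq : Λ ^ q = 2 ^ n := by
    rw [hΛdef, ENNReal.ofReal_rpow_of_pos (by positivity), ← Real.rpow_mul (by norm_num), hdq,
      Real.rpow_natCast, ENNReal.ofReal_pow (by norm_num)]
    simp
  set V : ℝ≥0∞ := ENNReal.ofReal (A ^ n * unitBallVolume n) ^ (1 / q) with hV
  have hVtop : V ≠ ⊤ := ENNReal.rpow_ne_top_of_nonneg (by positivity) ENNReal.ofReal_ne_top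
  have hV0 : V ≠ 0 := by
    rw [hV, Ne, ENNReal.rpow_eq_zero_iff]
    have h1 : ENNReal.ofReal (A ^ n * unitBallVolume n) ≠ 0 := by
      rw [Ne, ENNReal.ofReal_eq_zero, not_le]; positivity
    simp [h1]
  set η : ℝ≥0∞ := Λ⁻¹ ^ (1 / p) with hη
  have hη1 : η < 1 := by
    refine ENNReal.rpow_lt_one ?_ (by positivity)
    exact ENNReal.inv_lt_one.2 (lt_of_lt_of_le ENNReal.one_lt_two hΛ)
  -- 2V comes from the first J terms; V/(1 - η) is the geometric tail of ratio η.
  set T : ℝ≥0∞ := V * (2 + (1 - η)⁻¹) with hT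
  have hTtop : T ≠ ⊤ := by
    refine ENNReal.mul_ne_top hVtop (ENNReal.add_ne_top.2 ⟨by simp, ?_⟩)
    exact ENNReal.inv_ne_top.2 (tsub_pos_of_lt hη1).ne'
  have hT0 : T ≠ 0 := mul_ne_zero hV0 (by simp)
  refine ⟨T.toReal, ENNReal.toReal_pos hT0 hTtop, ?_⟩
  intro D g hgm hg J x hgood
  have hterm : ∀ j : ℕ, ENNReal.ofReal (((2 : ℝ) ^ d) ^ j) = Λ ^ j := fun j => by
    rw [ENNReal.ofReal_pow (by positivity)]
  have hJ1 : (1 : ℝ≥0∞) ≤ ((J : ℝ≥0∞) + 1) ^ (1 / q) :=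
    ENNReal.one_le_rpow le_add_self (by positivity)
  have hhead : ∑ j ∈ Finset.range J, Λ ^ j * ∫⁻ y in ball x (A * (1 / 2) ^ j) ∩ D, ‖g y‖ₑ
      ≤ V * 2 * ((J : ℝ≥0∞) + 1) ^ (1 / q) := by
    refine (sum_range_dyadic_le hΛ hpq hΛq hA hgm hg x J).trans ?_
    rw [ENNReal.mul_rpow_of_nonneg _ _ (by positivity),
      ENNReal.mul_rpow_of_nonneg _ _ (by positivity), ← ENNReal.rpow_mul,
      mul_one_div_cancel hq0.ne', ENNReal.rpow_one, ← hV, mul_comm, mul_comm V]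
    gcongr
    exact le_self_add
  have htail : ∑' k : ℕ, Λ ^ (k + J) * ∫⁻ y in ball x (A * (1 / 2) ^ (k + J)) ∩ D, ‖g y‖ₑ
      ≤ V * (1 - η)⁻¹ := by
    rw [← ENNReal.tsum_geometric, ← ENNReal.tsum_mul_left]
    refine ENNReal.tsum_le_tsum fun k => ?_
    refine (dyadic_term_le hpq hΛq hA hgm x (k + J)).trans ?_
    gcongr
    calc _ ≤ (Λ⁻¹ ^ k) ^ (1 / p) := by
          gcongr
          rw [add_comm]
          exact hgood k
      _ = η ^ k := by
          rw [hη, ← ENNReal.rpow_natCast_mul, ← ENNReal.rpow_mul_natCast, mul_comm]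
  rw [dyadicPotential]
  simp only [hterm]
  rw [← ENNReal.summable.sum_add_tsum_nat_add' (k := J)]
  calc _ ≤ V * 2 * ((J : ℝ≥0∞) + 1) ^ (1 / q)
          + V * (1 - η)⁻¹ * ((J : ℝ≥0∞) + 1) ^ (1 / q) :=
        add_le_add hhead (htail.trans (le_mul_of_one_le_right' hJ1))
    _ = T * ((J : ℝ≥0∞) + 1) ^ (1 / q) := by rw [hT]; ring
    _ = _ := by
        rw [ENNReal.ofReal_mul ENNReal.toReal_nonneg, ENNReal.ofReal_toReal hTtop,
          ← ENNReal.ofReal_rpow_of_pos (by positivity), ENNReal.ofReal_add (by positivity)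
          zero_le_one, ENNReal.ofReal_natCast, ENNReal.ofReal_one]

end Potential

/-! ### Hausdorff content and the exceptional sets. -/

section Content

variable {n : ℕ}

theorem hausdorffContent_mono {d : ℝ} {E F : Set (EuclideanSpace ℝ (Fin n))} (h : E ⊆ F) :
    hausdorffContent d E ≤ hausdorffContent d F :=
  le_iInf₂ fun x r => le_iInf fun hF => iInf₂_le_of_le x r (iInf_le_of_le (h.trans hF) le_rfl)

/-- Covers indexed by arbitrary countable types are admissible for the Hausdorff content. -/
theorem hausdorffContent_le_tsum {d : ℝ} (hd : 0 < d) {ι : Type*} [Countable ι]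
    {E : Set (EuclideanSpace ℝ (Fin n))} (x : ι → EuclideanSpace ℝ (Fin n)) (r : ι → ℝ≥0)
    (hE : E ⊆ ⋃ i, ball (x i) (r i)) :
    hausdorffContent d E ≤ ∑' i, (r i : ℝ≥0∞) ^ d := by
  obtain ⟨e, he⟩ := exists_injective_nat ι
  set x' : ℕ → EuclideanSpace ℝ (Fin n) := Function.extend e x 0 with hx'
  set r' : ℕ → ℝ≥0 := Function.extend e r 0 with hr'
  have hxe : ∀ i, x' (e i) = x i := fun i => he.extend_apply x 0 i
  have hre : ∀ i, r' (e i) = r i := fun i => he.extend_apply r 0 i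
  refine iInf₂_le_of_le x' r' (iInf_le_of_le ?_ (le_of_eq ?_))
  · refine hE.trans (iUnion_subset fun i => ?_)
    have := subset_iUnion (fun k => ball (x' k) (r' k)) (e i)
    rwa [hxe, hre] at this
  · rw [← he.tsum_eq (f := fun k => (r' k : ℝ≥0∞) ^ d)]
    · simp only [hre]
    · intro k hk
      by_contra hnot
      apply hk
      have : r' k = 0 := Function.extend_apply' _ _ _ fun ⟨i, hi⟩ => hnot ⟨i, hi⟩
      simp [this, hd]

theorem hausdorffContent_ne_top_of_isBounded {d : ℝ} (hd : 0 < d)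
    {E : Set (EuclideanSpace ℝ (Fin n))} (hE : Bornology.IsBounded E) :
    hausdorffContent d E ≠ ⊤ := by
  obtain ⟨R, hR0, hR⟩ := hE.subset_ball_lt 0 0
  refine ne_top_of_le_ne_top ?_ (hausdorffContent_le_tsum hd (ι := Unit) (fun _ => 0)
    (fun _ => ⟨R, hR0.le⟩) (fun y hy => mem_iUnion.2 ⟨(), hR hy⟩))
  rw [tsum_fintype, Finset.sum_const, Finset.card_univ, Fintype.card_unit, one_smul]
  exact ENNReal.rpow_ne_top_of_nonneg hd.le ENNReal.coe_ne_top

/-- Vitali covering estimate for the Hausdorff content of the set where a density concentrates. -/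
theorem hausdorffContent_concentration_le {d A : ℝ} (hd : 0 < d) (hA : 0 < A)
    {D : Set (EuclideanSpace ℝ (Fin n))} (hD : MeasurableSet D)
    {f : EuclideanSpace ℝ (Fin n) → ℝ≥0∞} (hf : ∫⁻ y in D, f y ≤ 1) (J : ℕ) :
    hausdorffContent d {x | ∃ k : ℕ, (ENNReal.ofReal (2 ^ d))⁻¹ ^ k
        < ∫⁻ y in ball x (A * (1 / 2) ^ (J + k)) ∩ D, f y}
      ≤ ENNReal.ofReal ((4 * A) ^ d) * (ENNReal.ofReal (2 ^ d))⁻¹ ^ J := by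
  set Λ : ℝ≥0∞ := ENNReal.ofReal (2 ^ d) with hΛ
  set E := {x | ∃ k : ℕ, Λ⁻¹ ^ k < ∫⁻ y in ball x (A * (1 / 2) ^ (J + k)) ∩ D, f y} with hE
  have hk : ∀ x, ∃ k : ℕ, x ∈ E → Λ⁻¹ ^ k < ∫⁻ y in ball x (A * (1 / 2) ^ (J + k)) ∩ D, f y := by
    intro x
    by_cases hx : x ∈ E
    · obtain ⟨k, hk⟩ := hx
      exact ⟨k, fun _ => hk⟩
    · exact ⟨0, fun h => absurd h hx⟩
  choose k hk using hk
  set r : EuclideanSpace ℝ (Fin n) → ℝ := fun x => A * (1 / 2) ^ (J + k x) with hr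
  have hr0 : ∀ x, 0 < r x := fun x => by positivity
  obtain ⟨U, hUE, hdisj, hcov⟩ := Vitali.exists_disjoint_subfamily_covering_enlargement_ball E
    (fun x => x) r A (fun x _ => mul_le_of_le_one_right hA.le
      (pow_le_one₀ (by norm_num) (by norm_num))) 4 (by norm_num)
  have hUc : U.Countable := hdisj.countable_of_isOpen (fun _ _ => isOpen_ball)
    fun x _ => ⟨x, mem_ball_self (hr0 x)⟩
  have : Countable U := hUc.to_subtype
  -- The factor Λ^(-k) is exactly the threshold defining E, so it is paid for by the integrals of f
  -- over the disjoint balls, which total at most 1.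
  have hrpow : ∀ x, ENNReal.ofReal (4 * r x) ^ d
      = ENNReal.ofReal ((4 * A) ^ d) * Λ⁻¹ ^ J * Λ⁻¹ ^ k x := by
    intro x
    rw [mul_assoc, ← pow_add, hΛ, ← ENNReal.ofReal_inv_of_pos (by positivity),
      ← ENNReal.ofReal_pow (by positivity), ← ENNReal.ofReal_mul (by positivity),
      ENNReal.ofReal_rpow_of_pos (by have := hr0 x; positivity)]
    congr 1
    simp only [hr]
    rw [← mul_assoc, Real.mul_rpow (by positivity) (by positivity)]
    congr 1
    rw [← Real.rpow_natCast, ← Real.rpow_mul (by norm_num), mul_comm _ d,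
      Real.rpow_mul (by norm_num), Real.rpow_natCast, one_div, Real.inv_rpow (by norm_num)]
  calc hausdorffContent d E
      ≤ ∑' x : U, ((4 * r x).toNNReal : ℝ≥0∞) ^ d := by
        refine hausdorffContent_le_tsum hd (fun x : U => (x : EuclideanSpace ℝ (Fin n)))
          (fun x : U => (4 * r x).toNNReal) fun x hx => ?_
        obtain ⟨b, hb, hsub⟩ := hcov x hx
        refine mem_iUnion.2 ⟨⟨b, hb⟩, ?_⟩
        rw [Real.coe_toNNReal _ (by have := hr0 b; positivity)]
        exact hsub (mem_ball_self (hr0 x))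
    _ = ∑' x : U, ENNReal.ofReal ((4 * A) ^ d) * Λ⁻¹ ^ J * Λ⁻¹ ^ k x :=
        tsum_congr fun x => hrpow x
    _ ≤ ENNReal.ofReal ((4 * A) ^ d) * Λ⁻¹ ^ J * ∑' x : U, ∫⁻ y in ball x.1 (r x) ∩ D, f y := by
        rw [ENNReal.tsum_mul_left]
        gcongr with x
        exact (hk x (hUE x.2)).le
    _ ≤ ENNReal.ofReal ((4 * A) ^ d) * Λ⁻¹ ^ J * 1 := by
        gcongr
        rw [← lintegral_iUnion (fun x : U => measurableSet_ball.inter hD)]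
        · exact (lintegral_mono_set (iUnion_subset fun _ => inter_subset_right)).trans hf
        · intro a b hab
          exact (hdisj a.2 b.2 fun h => hab (Subtype.ext h)).mono inter_subset_left
            inter_subset_left
    _ = _ := mul_one _

end Content

/-! ### From decay of content to exponential integrability. -/

section ExponentialIntegrability

variable {n : ℕ}

theorem lintegral_rpow_enorm_le_one_of_eLpNorm_le_one {α F : Type*} [MeasurableSpace α]
    [NormedAddCommGroup F] {μ : Measure α} {f : α → F} {p : ℝ} (hp : 0 < p)
    (hf : eLpNorm f (ENNReal.ofReal p) μ ≤ 1) : ∫⁻ x, ‖f x‖ₑ ^ p ∂μ ≤ 1 := by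
  rw [eLpNorm_eq_lintegral_rpow_enorm_toReal (by simpa using hp) ENNReal.ofReal_ne_top,
    ENNReal.toReal_ofReal hp.le] at hf
  have := ENNReal.rpow_le_rpow hf hp.le
  rwa [← ENNReal.rpow_mul, one_div_mul_cancel hp.ne', ENNReal.rpow_one, ENNReal.one_rpow] at this

/-- A Choquet integral is bounded by `π Q` if the content of the superlevel sets at height `t` is at
most `Q / (1 + t ^ 2)`. -/
theorem choquetIntegral_le_of_content_le {d Q : ℝ} (hQ : 0 ≤ Q)
    {D : Set (EuclideanSpace ℝ (Fin n))} {f : EuclideanSpace ℝ (Fin n) → ℝ}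
    (h : ∀ t : ℝ, 0 < t → hausdorffContent d {x ∈ D | t < |f x|}
      ≤ ENNReal.ofReal (Q * (1 + t ^ 2)⁻¹)) :
    choquetIntegral d D f ≤ ENNReal.ofReal (Q * Real.pi) := by
  calc choquetIntegral d D f ≤ ∫⁻ t in Ioi (0 : ℝ), ENNReal.ofReal (Q * (1 + t ^ 2)⁻¹) :=
        setLIntegral_mono' measurableSet_Ioi fun t ht => h t ht
    _ ≤ ∫⁻ t : ℝ, ENNReal.ofReal (Q * (1 + t ^ 2)⁻¹) := setLIntegral_le_lintegral _ _
    _ = ENNReal.ofReal (∫ t : ℝ, Q * (1 + t ^ 2)⁻¹) :=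
        (ofReal_integral_eq_lintegral_ofReal (integrable_inv_one_add_sq.const_mul Q)
          (ae_of_all _ fun t => by positivity)).symm
    _ = _ := by rw [integral_const_mul, integral_univ_inv_one_add_sq]

/-- If `|f| ≤ K (J + 1) ^ (1 / q)` off a set of content at most `M 2 ^ (-d J)`, for every `J`, then
the content of the superlevel sets of `exp (a |f| ^ q)` decays quadratically for small `a`. -/
theorem hausdorffContent_exp_superlevel_le {d q K M H : ℝ} (hd : 0 < d) (hq : 0 < q) (hK : 0 < K)
    (hM : 0 ≤ M) (hH : 0 ≤ H) {D : Set (EuclideanSpace ℝ (Fin n))}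
    (hDH : hausdorffContent d D ≤ ENNReal.ofReal H)
    {E : ℕ → Set (EuclideanSpace ℝ (Fin n))}
    (hE : ∀ J, hausdorffContent d (E J)
      ≤ ENNReal.ofReal M * (ENNReal.ofReal (2 ^ d))⁻¹ ^ J)
    {f : EuclideanSpace ℝ (Fin n) → ℝ}
    (hf : ∀ (J : ℕ), ∀ x ∈ D, x ∉ E J → |f x| ≤ K * ((J : ℝ) + 1) ^ (1 / q))
    {t : ℝ} (ht : 0 < t) :
    hausdorffContent d {x ∈ D | t < |Real.exp (d * Real.log 2 / (2 * K ^ q) * |f x| ^ q)|}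
      ≤ ENNReal.ofReal ((2 * M * (2 ^ d) ^ 2 + H * (1 + 2 ^ d)) * (1 + t ^ 2)⁻¹) := by
  set L : ℝ := (2 : ℝ) ^ d with hL
  have hL1 : 1 < L := Real.one_lt_rpow (by norm_num) hd
  have hL0 : 0 < L := by linarith
  have hLexp : L = Real.exp (d * Real.log 2) := by
    rw [hL, Real.rpow_def_of_pos (by norm_num), mul_comm]
  rcases lt_or_ge (t ^ 2) L with hsmall | hlarge
  · refine (hausdorffContent_mono (sep_subset _ _)).trans (hDH.trans ?_)
    apply ENNReal.ofReal_le_ofReal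
    rw [← div_eq_mul_inv, le_div_iff₀ (by positivity)]
    have : 0 ≤ 2 * M * L ^ 2 := by positivity
    nlinarith
  -- J satisfies L^(J+1) ≤ t² < L^(J+2). Off E J the exponential is at most L^((J+1)/2) ≤ t; the 2
  -- in the denominator of the exponent produces the decay t^(-2).
  · obtain ⟨J, hJ1, hJ2⟩ := exists_nat_pow_near ((one_le_div hL0).2 hlarge) hL1
    rw [le_div_iff₀ hL0, ← pow_succ] at hJ1
    rw [div_lt_iff₀ hL0] at hJ2
    have hsub : {x ∈ D | t < |Real.exp (d * Real.log 2 / (2 * K ^ q) * |f x| ^ q)|} ⊆ E J := by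
      rintro x ⟨hxD, hx⟩
      by_contra hxE
      have h1 : |f x| ^ q ≤ K ^ q * ((J : ℝ) + 1) := by
        have := Real.rpow_le_rpow (abs_nonneg _) (hf J x hxD hxE) hq.le
        rwa [Real.mul_rpow hK.le (by positivity), ← Real.rpow_mul (by positivity),
          one_div_mul_cancel hq.ne', Real.rpow_one] at this
      have hlog : 0 < Real.log 2 := Real.log_pos (by norm_num)
      have hKq : 0 < K ^ q := by positivity
      have h2 : d * Real.log 2 / (2 * K ^ q) * |f x| ^ q
          ≤ d * Real.log 2 * ((J : ℝ) + 1) / 2 := by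
        calc _ ≤ d * Real.log 2 / (2 * K ^ q) * (K ^ q * ((J : ℝ) + 1)) := by gcongr
          _ = _ := by field_simp
      rw [abs_of_pos (Real.exp_pos _)] at hx
      have h3 : t < Real.exp (d * Real.log 2 * ((J : ℝ) + 1) / 2) :=
        hx.trans_le (Real.exp_le_exp.2 h2)
      have h4 : t ^ 2 < L ^ (J + 1) := by
        calc t ^ 2 < Real.exp (d * Real.log 2 * ((J : ℝ) + 1) / 2) ^ 2 := by gcongr
          _ = L ^ (J + 1) := by
            rw [hLexp, ← Real.exp_nat_mul, ← Real.exp_nat_mul]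
            congr 1
            push_cast
            ring
      linarith
    refine (hausdorffContent_mono hsub).trans ((hE J).trans ?_)
    rw [← ENNReal.ofReal_inv_of_pos hL0, ← ENNReal.ofReal_pow (by positivity),
      ← ENNReal.ofReal_mul hM]
    apply ENNReal.ofReal_le_ofReal
    rw [inv_pow, ← div_eq_mul_inv, ← div_eq_mul_inv, div_le_div_iff₀ (by positivity)
      (by positivity)]
    have h5 : 1 + t ^ 2 ≤ 2 * (L ^ 2 * L ^ J) := by
      have : t ^ 2 < L ^ 2 * L ^ J := by
        calc t ^ 2 < L ^ (J + 1) * L := hJ2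
          _ = _ := by ring
      nlinarith
    calc M * (1 + t ^ 2) ≤ M * (2 * (L ^ 2 * L ^ J)) := by gcongr
      _ = 2 * M * L ^ 2 * L ^ J := by ring
      _ ≤ _ := by
          gcongr
          have : 0 ≤ H * (1 + L) := by positivity
          linarith

end ExponentialIntegrability

/-! ### The main theorem. -/

theorem corollary1p2 (n : ℕ) (hn : 2 ≤ n) (s : ℝ) (hs1 : 1 ≤ s) (hs2 : s < (n : ℝ) / ((n : ℝ) - 1))
    (D : Set (EuclideanSpace ℝ (Fin n))) (x₀ : EuclideanSpace ℝ (Fin n))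
    (hD : IsJohnDomainWithCenter s D x₀) :
    ∃ a b : ℝ, 0 < a ∧ 0 < b ∧
      ∀ (u : EuclideanSpace ℝ (Fin n) → ℝ)
        (g : EuclideanSpace ℝ (Fin n) → EuclideanSpace ℝ (Fin n)),
        HasWeakGradientOn D u g →
        eLpNorm g (ENNReal.ofReal ((n : ℝ) / ((n : ℝ) - s * ((n : ℝ) - 1))))
          (volume.restrict D) ≤ 1 →
        IntegrableOn u (ball x₀ (infDist x₀ (frontier D))) ∧
        ∀ v : EuclideanSpace ℝ (Fin n) → ℝ, IsPreciseRepresentativeOn D u v →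
          choquetIntegral (s * ((n : ℝ) - 1)) D
            (fun x => Real.exp (a *
              |v x - ⨍ y in ball x₀ (infDist x₀ (frontier D)), u y|
                ^ ((n : ℝ) / (s * ((n : ℝ) - 1))))) ≤ ENNReal.ofReal b := by
  have hnR : (2 : ℝ) ≤ n := by exact_mod_cast hn
  obtain ⟨A, c, C₁, hA, hc, hcδ, hC₁, hpoint⟩ := hD.exists_pointwise hn hs1
  obtain ⟨hDo, -, hDb, hx₀, -⟩ := hD
  set d : ℝ := s * ((n : ℝ) - 1) with hd
  have hd1 : 1 ≤ d := by nlinarith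
  have hd0 : 0 < d := by linarith
  -- The upper bound on s means d < n, which makes p a genuine exponent, conjugate to q.
  have hdn : d < n := by rwa [lt_div_iff₀ (by linarith)] at hs2
  set p : ℝ := (n : ℝ) / ((n : ℝ) - d) with hp
  set q : ℝ := (n : ℝ) / d with hq
  have hq0 : 0 < q := by positivity
  have hnd : 0 < (n : ℝ) - d := by linarith
  have hpq : p.HolderConjugate q := by
    rw [Real.holderConjugate_iff]
    refine ⟨(one_lt_div hnd).2 (by linarith), ?_⟩
    rw [hp, hq, inv_div, inv_div, ← add_div, sub_add_cancel, div_self (by linarith)]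
  have hdq : d * q = n := by rw [hq]; field_simp
  obtain ⟨C₂, hC₂, hpotential⟩ := exists_dyadicPotential_le n hd1 hpq hdq hA
  set R := infDist x₀ (frontier D) with hR
  have hR0 : 0 < R := by linarith
  -- W bounds the L¹ norm of g by Hölder; Y then bounds the difference of the averages over B(x₀, c)
  -- and B.
  set W : ℝ≥0∞ := volume D ^ (1 / q) with hW
  have hWtop : W ≠ ⊤ := ENNReal.rpow_ne_top_of_nonneg (by positivity) hDb.measure_lt_top.ne
  set Y : ℝ≥0∞ := (volume (ball x₀ R))⁻¹ *
    (ENNReal.ofReal (2 ^ (n + 1) * R ^ (n + 1) / c ^ n) * W) with hY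
  have hYtop : Y ≠ ⊤ := ENNReal.mul_ne_top
    (ENNReal.inv_ne_top.2 (measure_ball_pos _ _ hR0).ne')
    (ENNReal.mul_ne_top ENNReal.ofReal_ne_top hWtop)
  set K : ℝ := C₁ * C₂ + Y.toReal with hK
  have hK0 : 0 < K := by positivity
  set H : ℝ := (hausdorffContent d D).toReal with hH
  have hDH : hausdorffContent d D ≤ ENNReal.ofReal H := by
    rw [hH, ENNReal.ofReal_toReal (hausdorffContent_ne_top_of_isBounded hd0 hDb)]
  set Q : ℝ := 2 * (4 * A) ^ d * (2 ^ d) ^ 2 + H * (1 + 2 ^ d) with hQ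
  have hQ0 : 0 < Q := by
    have : 0 ≤ H := ENNReal.toReal_nonneg
    positivity
  refine ⟨d * Real.log 2 / (2 * K ^ q), Q * Real.pi,
    div_pos (mul_pos hd0 (Real.log_pos (by norm_num))) (by positivity), by positivity, ?_⟩
  intro u g h hgp
  have hgm : AEMeasurable (fun y => ‖g y‖ₑ) (volume.restrict D) :=
    h.2.1.aestronglyMeasurable.enorm
  have hg1 : ∫⁻ y in D, ‖g y‖ₑ ^ p ≤ 1 :=
    lintegral_rpow_enorm_le_one_of_eLpNorm_le_one hpq.pos hgp
  have hgW : ∫⁻ y in D, ‖g y‖ₑ ≤ W := by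
    have := ENNReal.lintegral_mul_le_Lp_mul_Lq (volume.restrict D) hpq hgm
      (aemeasurable_const (b := (1 : ℝ≥0∞)))
    simp only [Pi.mul_apply, mul_one, ENNReal.one_rpow, setLIntegral_const, one_mul] at this
    refine this.trans (mul_le_of_le_one_left' ?_)
    exact ENNReal.rpow_le_one hg1 (by have := hpq.pos; positivity)
  obtain ⟨hu_int, hav⟩ := h.integrableOn_ball_infDist hDo hx₀ hc (by linarith)
    (ne_top_of_le_ne_top hWtop hgW)
  refine ⟨hu_int, fun v hv => ?_⟩
  refine choquetIntegral_le_of_content_le hQ0.le fun t ht => ?_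
  refine hausdorffContent_exp_superlevel_le hd0 hq0 hK0 (by positivity) ENNReal.toReal_nonneg hDH
    (fun J => hausdorffContent_concentration_le hd0 hA hDo.measurableSet hg1 J)
    (f := fun x => v x - ⨍ y in ball x₀ R, u y) (fun J x hxD hxE => ?_) ht
  simp only [mem_ofPred_eq, not_exists, not_lt] at hxE
  have hpot := hpotential D g hgm hg1 J x hxE
  -- Off the exceptional set the potential is finite, so x is a Lebesgue point and v x is forced to
  -- equal b.
  obtain ⟨b, hb, hbC⟩ := hpoint u g h x hxD (ne_top_of_le_ne_top ENNReal.ofReal_ne_top hpot)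
  rw [hv x hxD b hb]
  set j : ℝ := ((J : ℝ) + 1) ^ (1 / q) with hj
  -- This lets the additive constant Y be absorbed into K j.
  have hj1 : 1 ≤ j := Real.one_le_rpow (by linarith [(Nat.cast_nonneg J : (0 : ℝ) ≤ J)])
    (by positivity)
  have havY : ‖(⨍ y in ball x₀ c, u y) - ⨍ y in ball x₀ R, u y‖ₑ ≤ ENNReal.ofReal Y.toReal := by
    rw [ENNReal.ofReal_toReal hYtop, ← enorm_neg, neg_sub]
    exact hav.trans (by rw [hY]; gcongr)
  have hmain : ‖b - ⨍ y in ball x₀ R, u y‖ₑ ≤ ENNReal.ofReal (K * j) := by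
    calc _ ≤ ENNReal.ofReal C₁ * ENNReal.ofReal (C₂ * j) + ENNReal.ofReal Y.toReal :=
          (enorm_sub_le_enorm_sub_add _ (⨍ y in ball x₀ c, u y) _).trans
            (add_le_add (hbC.trans (mul_le_mul_right hpot _)) havY)
      _ = ENNReal.ofReal (C₁ * (C₂ * j) + Y.toReal) := by
          rw [← ENNReal.ofReal_mul hC₁.le, ENNReal.ofReal_add (by positivity) (by positivity)]
      _ ≤ _ := by
          apply ENNReal.ofReal_le_ofReal
          have : 0 ≤ Y.toReal := ENNReal.toReal_nonneg
          rw [hK]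
          nlinarith
  rw [Real.enorm_eq_ofReal_abs, ENNReal.ofReal_le_ofReal_iff (by positivity)] at hmain
  exact hmain
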